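/- Let $0\le\lambda<2$, $\alpha=\frac1{2-\lambda}$, $\mathbb N=\{1,2,\dots\}$, and let $a_\lambda(k)=k^\lambda$ for $k\ge1$, $a_\lambda(0)=0$. For a sequence $V$ write $\partial^+V(k)=V(k+1)-V(k)$, $\partial^-V(k)=V(k)-V(k-1)$ and $$L_\lambda V(k)=\partial^-(a_\lambda\partial^+V)(k)=a_\lambda(k)\bigl(V(k+1)-V(k)\bigr)-a_\lambda(k-1)\bigl(V(k)-V(k-1)\bigr),\qquad k\ge 1,$$ where the last term is $0$ for $k=1$ (Neumann condition $(a_\lambda\partial^+V)(0)=0$). For $\mu\ge0$ let $X_\mu$ be the space of real sequences $V$ on $\mathbb N$ with $\|V\|_{X_\mu}=\sum_{k\ge1}k^\mu|V(k)|<\infty$, and write $\|V\|_1=\sum_{k\ge1}|V(k)|$, $\|V\|_\infty=\sup_{k\ge1}|V(k)|$. For $T\in(0,\infty]$ and $U_0\in X_\mu$, a solution in $X_\mu$ on $[0,T)$ with initial data $U_0$ of the Neumann problem $\partial_tU=L_\lambda U$, $(a_\lambda\partial^+U)(t,0)=0$, is a map $U\colon[0,T)\to X_\mu$ such that $t\mapsto\|U(t,\cdot)\|_{X_\mu}$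 lies in $L^\infty_{\mathrm{loc}}([0,T))$ and, for every $k\in\mathbb N$, $t\mapsto U(t,k)$ is continuous on $[0,T)$ with $$U(t,k)=U_0(k)+\int_0^tL_\lambda U(s,k)\,ds\qquad(0\le t<T).$$ Define $\theta_\lambda\colon(0,\infty)\to\mathbb R$ and $\omega_\lambda\colon[1,\infty)\to[0,\infty)$ by $$\theta_\lambda(x)=\begin{cases}\frac1{1-\lambda}x^{1-\lambda},&\lambda\ne1,\\ \log x,&\lambda=1,\end{cases}\qquad \omega_\lambda(r)=\begin{cases}\frac2{|1-\alpha|}\Bigl|\bigl(r-\tfrac12\bigr)^{\frac{1-\alpha}2}-\bigl(\tfrac12\bigr)^{\frac{1-\alpha}2}\Bigr|,&\lambda\ne1,\\ \log(2r-1),&\lambda=1.\end{cases}$$ **Theorem (Decay and continuity).** The functions $\theta_\lambda$ and $\omega_\lambda$ are continuous, $\theta_\lambda>0$ if $\lambda<1$, $\omega_\lambda\ge0$ and $\omega_\lambda(1)=0$. There is a constant $C=C(\lambda)>0$, depending only on $\lambda$, such that for all $\mu\ge0$, $T\in(0,\infty]$, $U_0\in X_\mu$ and every solution $U$ in $X_\mu$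 on $[0,T)$ with initial data $U_0$: $$\|U(t,\cdot)\|_\infty\le C\,\|U_0\|_1\,(1+t)^{-\alpha}\qquad\text{for all }0\le t<T,$$ $$|U(t,k_2)-U(t,k_1)|\le C\,\|U_0\|_1\,t^{-\alpha}\,\bigl|\theta_\lambda(t^{-\alpha}k_2)-\theta_\lambda(t^{-\alpha}k_1)\bigr|^{\frac12}\qquad\text{for all }0<t<T,\ k_1,k_2\in\mathbb N,$$ $$|U(t,k)-U(s,k)|\le C\,\|U_0\|_1\,s^{-\alpha}\,\omega_\lambda(t/s)\qquad\text{for all }0<s\le t<T,\ k\in\mathbb N.$$ -/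

import Mathlib

/-! Sequences on `{1, 2, 3, …}` are represented by functions `ℕ → ℝ`; the value at the index `0` is
left unspecified and never enters any of the notions below. -/

noncomputable section

namespace WeightedHeat

/-- The weight `a_λ`: `a_λ(k) = k ^ λ` for `k ≥ 1` and `a_λ(0) = 0` (also when `λ = 0`). -/
def weight (lam : ℝ) (k : ℕ) : ℝ :=
  if k = 0 then 0 else (k : ℝ) ^ lam

/-- The forward difference `∂⁺ V (k) = V (k + 1) - V k`. -/
def dPlus (V : ℕ → ℝ) (k : ℕ) : ℝ :=
  V (k + 1) - V k

/-- The backward difference `∂⁻ V (k) = V k - V (k - 1)`, used for `k ≥ 1`. -/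
def dMinus (V : ℕ → ℝ) (k : ℕ) : ℝ :=
  V k - V (k - 1)

/-- The operator `L_λ V = ∂⁻ (a_λ ∂⁺ V)`, used for `k ≥ 1`. Since `a_λ(0) = 0`, the flux
`a_λ ∂⁺ V` vanishes at `0`, which is the Neumann condition. -/
def opL (lam : ℝ) (V : ℕ → ℝ) (k : ℕ) : ℝ :=
  dMinus (fun j => weight lam j * dPlus V j) k

/-- Membership in the weighted space `X_μ`: `∑_{k ≥ 1} k ^ μ |V k| < ∞`
(for `μ ≥ 0` this implies that `V` is bounded on `k ≥ 1`). -/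
def MemX (mu : ℝ) (V : ℕ → ℝ) : Prop :=
  Summable fun k : ℕ => ((k + 1 : ℕ) : ℝ) ^ mu * |V (k + 1)|

/-- The norm `∑_{k ≥ 1} k ^ μ |V k|` of `X_μ`. -/
def normX (mu : ℝ) (V : ℕ → ℝ) : ℝ :=
  ∑' k : ℕ, ((k + 1 : ℕ) : ℝ) ^ mu * |V (k + 1)|

/-- The norm `‖V‖₁ = ∑_{k ≥ 1} |V k|`. -/
def normOne (V : ℕ → ℝ) : ℝ :=
  ∑' k : ℕ, |V (k + 1)|

/-- The norm `‖V‖_∞ = sup_{k ≥ 1} |V k|`. -/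
def normSup (V : ℕ → ℝ) : ℝ :=
  ⨆ k : ℕ, |V (k + 1)|

/-- The time interval `[0, T)`, where `T ∈ (0, ∞]`. -/
def timeInterval (T : EReal) : Set ℝ :=
  {t : ℝ | 0 ≤ t ∧ (t : EReal) < T}

/-- `U` is a solution on `[0, T)`, in the space `X_μ` and with initial data `U₀`, of the
Neumann problem `∂_t U = L_λ U`, `(a_λ ∂⁺ U)(t, 0) = 0`. -/
structure IsSolution (lam mu : ℝ) (T : EReal) (U₀ : ℕ → ℝ) (U : ℝ → ℕ → ℝ) : Prop where
  memX_init : MemX mu U₀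
  memX : ∀ t ∈ timeInterval T, MemX mu (U t)
  /-- The map `t ↦ ‖U(t, ·)‖_{X_μ}` belongs to `L^∞_loc([0, T))`. -/
  locallyBounded : ∀ S ∈ timeInterval T,
    MeasureTheory.MemLp (fun t => normX mu (U t)) ⊤
      (MeasureTheory.volume.restrict (Set.Icc 0 S))
  continuousOn : ∀ k : ℕ, 1 ≤ k → ContinuousOn (fun t => U t k) (timeInterval T)
  integral_eq : ∀ k : ℕ, 1 ≤ k → ∀ t ∈ timeInterval T,
    U t k = U₀ k + ∫ s in (0 : ℝ)..t, opL lam (U s) k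

/-- The exponent `α = 1 / (2 - λ)`. -/
def alpha (lam : ℝ) : ℝ :=
  1 / (2 - lam)

/-- The function `θ_λ`, used on `(0, ∞)`. -/
def theta (lam x : ℝ) : ℝ :=
  if lam = 1 then Real.log x else 1 / (1 - lam) * x ^ (1 - lam)

/-- The function `ω_λ`, used on `[1, ∞)`. -/
def omega (lam r : ℝ) : ℝ :=
  if lam = 1 then Real.log (2 * r - 1)
  else 2 / |1 - alpha lam| *
    |(r - 1 / 2) ^ ((1 - alpha lam) / 2) - (1 / 2 : ℝ) ^ ((1 - alpha lam) / 2)|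

end WeightedHeat

end

namespace WeightedHeat

open Finset

/-! The argument is Nash's method for heat kernels, run on finite truncations and transferred to the
solution by a limit. On `{1, …, N}` with a Dirichlet condition at `N + 1`, `L_λ` is a symmetric
matrix `truncL` with nonnegative off-diagonal entries, so its semigroup has a nonnegative symmetric
kernel `p` of mass at most `1`.

The weighted Nash inequality `nash_of_mass_le_one`, `c ‖V‖₂^(2(1 + 1/α)) ≤ E(V)` with `E` the
Dirichlet form, turns `d/dt ‖p‖₂² = -2 E(p)` into `‖p‖₂² ≲ (1 + t)^(-α)`. The energy is
nonincreasing, whence `E(p) ≲ t^(-1-α)`. All three estimates for `p` follow, uniformly in `N`: `p`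
itself and its time derivative are inner products, respectively Dirichlet products, of columns at
time `t / 2` (`kernelCol_le`, `exists_hasDerivAt_kernelCol`), and spatial differences are bounded by
Cauchy–Schwarz against the energy (`sq_sub_kernelCol_le`).

Duhamel's formula expresses the difference between a solution and its truncation by the flux through
the cut-off. The supersolution `k²` shows that the kernel there is `O(N⁻²)`, which offsets `a_λ(N) ≤
N²`; the remaining factor `∫ |U(s, N + 1)| ds` tends to `0` because it is summable in `N`. Hence
`tendsto_truncSol`, and the estimates pass to the limit. -/

/-! ### A weighted Nash inequality on the half-line -/

lemma sum_range_rpow_le {s : ℝ} (hs0 : 0 < s) (hs1 : s ≤ 1) (R : ℕ) :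
    ∑ i ∈ range R, ((i : ℝ) + 1) ^ (s - 1) ≤ (R : ℝ) ^ s / s := by
  induction R with
  | zero => simp [Real.zero_rpow hs0.ne']
  | succ R ih =>
    rw [sum_range_succ]
    have hR : (0 : ℝ) < (R : ℝ) + 1 := by positivity
    -- Bernoulli's inequality for exponents in `[0, 1]`: `(1 - 1/(R+1))^s ≤ 1 - s/(R+1)`, so `R^s /
    -- s` grows by at least `(R+1)^(s-1)` per step.
    have hb := rpow_one_add_le_one_add_mul_self (s := -1 / ((R : ℝ) + 1))
      (by rw [le_div_iff₀ hR]; linarith [(Nat.cast_nonneg R : (0 : ℝ) ≤ R)]) hs0.le hs1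
    have he : (1 + -1 / ((R : ℝ) + 1)) = R / (R + 1) := by field_simp; ring
    rw [he, Real.div_rpow (Nat.cast_nonneg R) hR.le, div_le_iff₀ (by positivity)] at hb
    have h1 : ((R : ℝ) + 1) ^ (s - 1) = (R + 1) ^ s / (R + 1) := by
      rw [Real.rpow_sub hR, Real.rpow_one]
    have h2 : (R : ℝ) ^ s / s + ((R : ℝ) + 1) ^ s / (R + 1) ≤ ((R : ℝ) + 1) ^ s / s := by
      rw [← sub_nonneg]
      have : ((R : ℝ) + 1) ^ s / s - ((R : ℝ) ^ s / s + ((R : ℝ) + 1) ^ s / (R + 1))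
          = ((1 + s * (-1 / (R + 1))) * (R + 1) ^ s - R ^ s) / s := by
        field_simp; ring
      rw [this]
      exact div_nonneg (by linarith) hs0.le
    push_cast
    linarith [h1]

lemma sum_shift_eq_sum_filter {N R k : ℕ} {g : ℕ → ℝ} (hg : ∀ i, N ≤ i → g i = 0) :
    ∑ i ∈ Ico k (k + R), g i = ∑ i ∈ range N with k ≤ i ∧ i < k + R, g i := by
  symm
  apply sum_subset
  · intro i hi
    simp only [mem_filter, mem_Ico] at hi ⊢
    exact hi.2
  · intro i hi hi'
    simp only [mem_filter, mem_Ico, mem_range, not_and] at hi hi'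
    apply hg
    by_contra h
    exact hi' (by omega) hi.1 hi.2

/-- After exchanging the sums, an index `i` lies in at most `R` windows by their length, and in at
most `i + 1` because windows start at `k ≥ 0`. The second count is what later produces a weight in
`i`. -/
lemma sum_sum_shift_le {N R : ℕ} {g : ℕ → ℝ} (hg0 : ∀ i, 0 ≤ g i) (hg : ∀ i, N ≤ i → g i = 0) :
    ∑ k ∈ range N, ∑ i ∈ Ico k (k + R), g i ≤
      ∑ i ∈ range N, ((min (i + 1) R : ℕ) : ℝ) * g i := by
  simp_rw [sum_shift_eq_sum_filter hg, sum_filter]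
  rw [sum_comm]
  refine sum_le_sum fun i _ => ?_
  rw [← sum_filter, sum_const, nsmul_eq_mul]
  refine mul_le_mul_of_nonneg_right ?_ (hg0 i)
  have h : (range N).filter (fun k => k ≤ i ∧ i < k + R) ⊆ Ico (i + 1 - R) (i + 1) := by
    intro k hk
    simp only [mem_filter, mem_Ico] at hk ⊢
    omega
  have h' := card_le_card h
  rw [Nat.card_Ico] at h'
  exact_mod_cast h'.trans (by omega)

lemma natCast_min_le_rpow_mul_rpow {a b : ℕ} {s : ℝ} (hs0 : 0 ≤ s) (hs1 : s ≤ 1) :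
    ((min a b : ℕ) : ℝ) ≤ (a : ℝ) ^ (1 - s) * (b : ℝ) ^ s := by
  have h0 : (0 : ℝ) ≤ ((min a b : ℕ) : ℝ) := Nat.cast_nonneg _
  calc ((min a b : ℕ) : ℝ) = ((min a b : ℕ) : ℝ) ^ ((1 - s) + s) := by simp
    _ = ((min a b : ℕ) : ℝ) ^ (1 - s) * ((min a b : ℕ) : ℝ) ^ s :=
        Real.rpow_add_of_nonneg h0 (by linarith) hs0
    _ ≤ _ := by
        gcongr
        · exact min_le_left _ _
        · exact min_le_right _ _

lemma abs_sub_le_sum_Ico (V : ℕ → ℝ) {k j n : ℕ} (hkj : k ≤ j) (hjn : j ≤ n) :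
    |V k - V j| ≤ ∑ i ∈ Ico k n, |V (i + 1) - V i| := by
  rw [abs_sub_comm, ← sum_Ico_sub V hkj]
  exact (abs_sum_le_sum_abs _ _).trans
    (sum_le_sum_of_subset_of_nonneg (Ico_subset_Ico_right hjn) fun _ _ _ => abs_nonneg _)

/-- Cauchy–Schwarz with only half of the weight exponent: since `λ/2 < 1`, the sum of `(i+1)^(-λ/2)`
over a window is largest at the origin and of order `R^(1-λ/2)`. -/
lemma sq_sum_Ico_abs_le {lam : ℝ} (hlam0 : 0 ≤ lam) (hlam2 : lam < 2) (d : ℕ → ℝ) (k R : ℕ) :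
    (∑ i ∈ Ico k (k + R), |d i|) ^ 2 ≤ (R : ℝ) ^ (1 - lam / 2) / (1 - lam / 2) *
      ∑ i ∈ Ico k (k + R), ((i : ℝ) + 1) ^ (lam / 2) * d i ^ 2 := by
  have hcs := sum_sq_le_sum_mul_sum_of_sq_le_mul (Ico k (k + R)) (r := fun i => |d i|)
    (f := fun i => ((i : ℝ) + 1) ^ (-(lam / 2)))
    (g := fun i => ((i : ℝ) + 1) ^ (lam / 2) * d i ^ 2)
    (fun i _ => by positivity) (fun i _ => by positivity)
    (fun i _ => by
      have : (0 : ℝ) < (i : ℝ) + 1 := by positivity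
      rw [← mul_assoc, ← Real.rpow_add this]
      simp)
  refine hcs.trans (mul_le_mul_of_nonneg_right ?_ (sum_nonneg fun i _ => by positivity))
  have h := sum_range_rpow_le (s := 1 - lam / 2) (by linarith) (by linarith) R
  refine le_trans ?_ h
  rw [sum_Ico_eq_sum_range, Nat.add_sub_cancel_left]
  refine sum_le_sum fun i _ => ?_
  have e : 1 - lam / 2 - 1 = -(lam / 2) := by ring
  rw [e]
  refine Real.rpow_le_rpow_of_nonpos (by positivity) ?_ (by linarith)
  push_cast
  linarith [(Nat.cast_nonneg k : (0 : ℝ) ≤ k)]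

/-- A Nash inequality with an explicit scale `R`. -/
lemma sum_sq_le_energy_add_mass {lam : ℝ} (hlam0 : 0 ≤ lam) (hlam2 : lam < 2) {N R : ℕ}
    (hR : 1 ≤ R) {V : ℕ → ℝ} (hV0 : ∀ i, 0 ≤ V i) (hV : ∀ i, N ≤ i → V i = 0) :
    ∑ k ∈ range N, V k ^ 2 ≤
      2 * ((R : ℝ) ^ (2 - lam) / (1 - lam / 2) *
        ∑ i ∈ range N, ((i : ℝ) + 1) ^ lam * (V (i + 1) - V i) ^ 2) +
      2 * ((∑ i ∈ range N, V i) ^ 2 / R) := by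
  have hRpos : (0 : ℝ) < R := by exact_mod_cast hR
  set m := ∑ i ∈ range N, V i with hm
  have hm0 : 0 ≤ m := sum_nonneg fun i _ => hV0 i
  set A : ℕ → ℝ := fun k => (∑ i ∈ Ico k (k + R), V i) / R with hA
  set D : ℕ → ℝ := fun k => ∑ i ∈ Ico k (k + R), |V (i + 1) - V i| with hD
  have hA0 : ∀ k, 0 ≤ A k := fun k => div_nonneg (sum_nonneg fun i _ => hV0 i) hRpos.le
  -- `V k` exceeds its average over a window of length `R` by at most the variation over that
  -- window.
  have hVA : ∀ k, V k ≤ A k + D k := by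
    intro k
    have h : ∑ i ∈ Ico k (k + R), (V k - D k) ≤ ∑ i ∈ Ico k (k + R), V i := by
      refine sum_le_sum fun i hi => ?_
      rw [mem_Ico] at hi
      have := abs_sub_le_sum_Ico V hi.1 hi.2.le
      have := le_abs_self (V k - V i)
      simp only [hD]
      linarith
    rw [sum_const, Nat.card_Ico, Nat.add_sub_cancel_left, nsmul_eq_mul] at h
    have : V k - D k ≤ A k := by
      simp only [hA]
      rw [le_div_iff₀ hRpos]
      linarith
    linarith
  have hsq : ∀ k, V k ^ 2 ≤ 2 * D k ^ 2 + 2 * A k ^ 2 := by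
    intro k
    have h1 := pow_le_pow_left₀ (hV0 k) (hVA k) 2
    nlinarith [sq_nonneg (A k - D k)]
  have hAm : ∀ k, A k ≤ m / R := by
    intro k
    simp only [hA]
    rw [sum_shift_eq_sum_filter hV]
    gcongr
    exact sum_le_sum_of_subset_of_nonneg (filter_subset _ _) fun i _ _ => hV0 i
  have hAs : ∑ k ∈ range N, A k ≤ m := by
    simp only [hA]
    rw [← sum_div, div_le_iff₀ hRpos, hm, sum_mul]
    refine (sum_sum_shift_le hV0 hV).trans (sum_le_sum fun i _ => ?_)
    rw [mul_comm]
    refine mul_le_mul_of_nonneg_left ?_ (hV0 i)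
    exact_mod_cast min_le_right _ _
  have hAsq : ∑ k ∈ range N, A k ^ 2 ≤ m ^ 2 / R := by
    calc ∑ k ∈ range N, A k ^ 2 ≤ ∑ k ∈ range N, (m / R) * A k :=
          sum_le_sum fun k _ => by
            rw [sq]; exact mul_le_mul_of_nonneg_right (hAm k) (hA0 k)
      _ = (m / R) * ∑ k ∈ range N, A k := by rw [mul_sum]
      _ ≤ (m / R) * m := by gcongr
      _ = m ^ 2 / R := by ring
  have hDsq : ∑ k ∈ range N, D k ^ 2 ≤ (R : ℝ) ^ (2 - lam) / (1 - lam / 2) *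
        ∑ i ∈ range N, ((i : ℝ) + 1) ^ lam * (V (i + 1) - V i) ^ 2 := by
    have hs : (0 : ℝ) < 1 - lam / 2 := by linarith
    have hg : ∀ i, N ≤ i → ((i : ℝ) + 1) ^ (lam / 2) * (V (i + 1) - V i) ^ 2 = 0 := by
      intro i hi
      rw [hV i hi, hV (i + 1) (by omega)]
      simp
    calc ∑ k ∈ range N, D k ^ 2
        ≤ ∑ k ∈ range N, (R : ℝ) ^ (1 - lam / 2) / (1 - lam / 2) *
            ∑ i ∈ Ico k (k + R), ((i : ℝ) + 1) ^ (lam / 2) * (V (i + 1) - V i) ^ 2 :=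
          sum_le_sum fun k _ => sq_sum_Ico_abs_le hlam0 hlam2 (fun i => V (i + 1) - V i) k R
      _ ≤ (R : ℝ) ^ (1 - lam / 2) / (1 - lam / 2) * ∑ i ∈ range N,
            ((min (i + 1) R : ℕ) : ℝ) * (((i : ℝ) + 1) ^ (lam / 2) * (V (i + 1) - V i) ^ 2) := by
          rw [← mul_sum]
          exact mul_le_mul_of_nonneg_left
            (sum_sum_shift_le (fun i => by positivity) hg) (by positivity)
      _ ≤ (R : ℝ) ^ (1 - lam / 2) / (1 - lam / 2) * ∑ i ∈ range N,
            (((i : ℝ) + 1) ^ (lam / 2) * (R : ℝ) ^ (1 - lam / 2)) *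
              (((i : ℝ) + 1) ^ (lam / 2) * (V (i + 1) - V i) ^ 2) := by
          gcongr with i hi
          -- Interpolating between the two window counts restores the missing half `(i+1)^(λ/2)` of
          -- the weight.
          have := natCast_min_le_rpow_mul_rpow (a := i + 1) (b := R) (s := 1 - lam / 2)
            hs.le (by linarith)
          rw [show 1 - (1 - lam / 2) = lam / 2 by ring] at this
          push_cast at this ⊢
          exact this
      _ = _ := by
          rw [mul_sum, mul_sum]
          refine sum_congr rfl fun i _ => ?_
          have e1 : (R : ℝ) ^ (2 - lam) = (R : ℝ) ^ (1 - lam / 2) * (R : ℝ) ^ (1 - lam / 2) := by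
            rw [← Real.rpow_add hRpos]; ring_nf
          have e2 : ((i : ℝ) + 1) ^ lam
              = ((i : ℝ) + 1) ^ (lam / 2) * ((i : ℝ) + 1) ^ (lam / 2) := by
            rw [← Real.rpow_add (by positivity)]; ring_nf
          rw [e1, e2]
          ring
  calc ∑ k ∈ range N, V k ^ 2 ≤ ∑ k ∈ range N, (2 * D k ^ 2 + 2 * A k ^ 2) :=
        sum_le_sum fun k _ => hsq k
    _ = 2 * ∑ k ∈ range N, D k ^ 2 + 2 * ∑ k ∈ range N, A k ^ 2 := by
        rw [sum_add_distrib, mul_sum, mul_sum]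
    _ ≤ _ := by gcongr

/-- The constant in the Nash inequality `nash_of_mass_le_one`. -/
noncomputable def nashConst (lam : ℝ) : ℝ := (1 - lam / 2) / (4 * 5 ^ (2 - lam))

lemma nashConst_pos {lam : ℝ} (hlam2 : lam < 2) : 0 < nashConst lam := by
  unfold nashConst
  have : 0 < 1 - lam / 2 := by linarith
  positivity

/-- The Nash inequality for nonnegative sequences of mass at most `1`. -/
lemma nash_of_mass_le_one {lam : ℝ} (hlam0 : 0 ≤ lam) (hlam2 : lam < 2) {N : ℕ}
    {V : ℕ → ℝ} (hV0 : ∀ i, 0 ≤ V i) (hV : ∀ i, N ≤ i → V i = 0)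
    (hmass : ∑ i ∈ range N, V i ≤ 1) (hpos : 0 < ∑ k ∈ range N, V k ^ 2) :
    nashConst lam * (∑ k ∈ range N, V k ^ 2) ^ (1 + (2 - lam)) ≤
      ∑ i ∈ range N, ((i : ℝ) + 1) ^ lam * (V (i + 1) - V i) ^ 2 := by
  set x := ∑ k ∈ range N, V k ^ 2 with hx
  set E := ∑ i ∈ range N, ((i : ℝ) + 1) ^ lam * (V (i + 1) - V i) ^ 2 with hE
  have hE0 : 0 ≤ E := sum_nonneg fun i _ => by positivity
  have hm0 : 0 ≤ ∑ i ∈ range N, V i := sum_nonneg fun i _ => hV0 i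
  have hx1 : x ≤ 1 := by
    calc x ≤ ∑ k ∈ range N, V k := by
          refine sum_le_sum fun k hk => ?_
          have : V k ≤ 1 := (single_le_sum (fun i _ => hV0 i) hk).trans hmass
          nlinarith [hV0 k]
      _ ≤ 1 := hmass
  have hs : (0 : ℝ) < 1 - lam / 2 := by linarith
  -- The choice `R ≥ 4 / x` makes the mass term at most `x / 2`, so the left side absorbs it; `x ≤
  -- 1` pays for the rounding, `4 / x + 1 ≤ 5 / x`.
  obtain ⟨R, hR4, hR5⟩ : ∃ R : ℕ, 4 / x ≤ R ∧ (R : ℝ) ≤ 5 / x := by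
    refine ⟨⌈4 / x⌉₊, Nat.le_ceil _, (Nat.ceil_lt_add_one (by positivity)).le.trans ?_⟩
    have : 1 ≤ 1 / x := by rw [le_div_iff₀ hpos]; linarith
    calc 4 / x + 1 ≤ 4 / x + 1 / x := by gcongr
      _ = 5 / x := by ring
  have hRpos : (0 : ℝ) < R := lt_of_lt_of_le (by positivity) hR4
  have hR1 : 1 ≤ R := by exact_mod_cast hRpos
  have hN := sum_sq_le_energy_add_mass hlam0 hlam2 hR1 hV0 hV
  have h1 : (∑ i ∈ range N, V i) ^ 2 / R ≤ x / 4 := by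
    rw [div_le_iff₀ hRpos]
    have : 4 ≤ R * x := by rwa [div_le_iff₀ hpos] at hR4
    nlinarith
  have h2 : x / 4 ≤ (R : ℝ) ^ (2 - lam) / (1 - lam / 2) * E := by linarith
  have h3 : (R : ℝ) ^ (2 - lam) ≤ 5 ^ (2 - lam) / x ^ (2 - lam) := by
    rw [← Real.div_rpow (by norm_num) hpos.le]
    exact Real.rpow_le_rpow hRpos.le hR5 (by linarith)
  have h4 : x / 4 ≤ 5 ^ (2 - lam) / x ^ (2 - lam) / (1 - lam / 2) * E :=
    h2.trans (by gcongr)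
  have hxp : 0 < x ^ (2 - lam) := by positivity
  rw [Real.rpow_add hpos, Real.rpow_one, nashConst]
  calc (1 - lam / 2) / (4 * 5 ^ (2 - lam)) * (x * x ^ (2 - lam))
      = (1 - lam / 2) * x ^ (2 - lam) / 5 ^ (2 - lam) * (x / 4) := by ring
    _ ≤ (1 - lam / 2) * x ^ (2 - lam) / 5 ^ (2 - lam) *
          (5 ^ (2 - lam) / x ^ (2 - lam) / (1 - lam / 2) * E) := by gcongr
    _ = E := by field_simp [(by linarith : (2 : ℝ) - lam ≠ 0)]

/-! ### Matrix semigroups: positivity, comparison, energy -/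

section Semigroup

open scoped Matrix Matrix.Norms.Operator Nat

variable {ι : Type*} [Fintype ι] [DecidableEq ι]

/-- The semigroup `exp (t A)` generated by a matrix `A`. -/
noncomputable def heat (A : Matrix ι ι ℝ) (t : ℝ) : Matrix ι ι ℝ :=
  NormedSpace.exp (t • A)

lemma heat_zero (A : Matrix ι ι ℝ) : heat A 0 = 1 := by simp [heat]

lemma heat_add (A : Matrix ι ι ℝ) (s t : ℝ) : heat A (s + t) = heat A s * heat A t := by
  rw [heat, add_smul, Matrix.exp_add_of_commute]
  · rfl
  · exact ((Commute.refl A).smul_left s).smul_right t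

lemma heat_transpose {A : Matrix ι ι ℝ} (hA : A.IsSymm) (t : ℝ) (i j : ι) :
    heat A t i j = heat A t j i :=
  ((hA.smul t).exp.apply j i)

lemma hasDerivAt_heat_apply (A : Matrix ι ι ℝ) (t : ℝ) (i j : ι) :
    HasDerivAt (fun t => heat A t i j) ((heat A t * A) i j) t :=
  (Matrix.entryLinearMap ℝ ℝ i j).toContinuousLinearMap.hasFDerivAt.comp_hasDerivAt t
    (hasDerivAt_exp_smul_const A t)

lemma hasDerivAt_heat_apply' (A : Matrix ι ι ℝ) (t : ℝ) (i j : ι) :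
    HasDerivAt (fun t => heat A t i j) ((A * heat A t) i j) t :=
  (Matrix.entryLinearMap ℝ ℝ i j).toContinuousLinearMap.hasFDerivAt.comp_hasDerivAt t
    (hasDerivAt_exp_smul_const' A t)

lemma exp_apply_nonneg {B : Matrix ι ι ℝ} (hB : ∀ i j, 0 ≤ B i j) (i j : ι) :
    0 ≤ NormedSpace.exp B i j := by
  have hpow : ∀ n : ℕ, ∀ i j, 0 ≤ (B ^ n) i j := by
    intro n
    induction n with
    | zero =>
      intro i j
      rw [pow_zero, Matrix.one_apply]
      split_ifs <;> norm_num
    | succ n ih =>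
      intro i j
      rw [pow_succ, Matrix.mul_apply]
      exact sum_nonneg fun k _ => mul_nonneg (ih i k) (hB k j)
  have h := (Matrix.entryLinearMap ℝ ℝ i j).toContinuousLinearMap.hasSum
    (NormedSpace.exp_series_hasSum_exp' (𝕂 := ℝ) B)
  refine h.nonneg fun n => ?_
  change 0 ≤ ((n !⁻¹ : ℝ) • B ^ n) i j
  rw [Matrix.smul_apply, smul_eq_mul]
  exact mul_nonneg (by positivity) (hpow n i j)

/-- A large multiple of the identity makes all entries of the generator nonnegative; being central,
it only contributes a positive scalar factor to the exponential. -/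
lemma heat_nonneg {A : Matrix ι ι ℝ} (hA : ∀ i j, i ≠ j → 0 ≤ A i j) {t : ℝ} (ht : 0 ≤ t)
    (i j : ι) : 0 ≤ heat A t i j := by
  set c : ℝ := ∑ i, |A i i| with hc
  have hB : ∀ i j, 0 ≤ (t • (A + algebraMap ℝ (Matrix ι ι ℝ) c)) i j := by
    intro i j
    rw [Matrix.smul_apply, smul_eq_mul, Matrix.add_apply, Matrix.algebraMap_matrix_apply]
    refine mul_nonneg ht ?_
    by_cases h : i = j
    · subst h
      have := single_le_sum (f := fun i => |A i i|) (fun i _ => abs_nonneg _) (mem_univ i)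
      have := neg_abs_le (A i i)
      simp only [if_true, Algebra.algebraMap_self, RingHom.id_apply]
      linarith
    · simpa [h] using hA i j h
  have hsplit : t • A = algebraMap ℝ (Matrix ι ι ℝ) (-(t * c)) +
      t • (A + algebraMap ℝ (Matrix ι ι ℝ) c) := by
    rw [smul_add, map_neg, map_mul, ← Algebra.smul_def]
    abel
  have hexp : NormedSpace.exp (algebraMap ℝ (Matrix ι ι ℝ) (-(t * c))) =
      algebraMap ℝ (Matrix ι ι ℝ) (Real.exp (-(t * c))) := by
    rw [Real.exp_eq_exp_ℝ]
    exact (NormedSpace.algebraMap_exp_comm (𝕂 := ℝ) (-(t * c))).symm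
  have h : heat A t = Real.exp (-(t * c)) •
      NormedSpace.exp (t • (A + algebraMap ℝ (Matrix ι ι ℝ) c)) := by
    rw [heat, hsplit, Matrix.exp_add_of_commute _ _ (Algebra.commute_algebraMap_left _ _)]
    exact (congrArg (fun X => X * NormedSpace.exp (t • (A + algebraMap ℝ (Matrix ι ι ℝ) c)))
      hexp).trans (Algebra.smul_def _ _).symm
  rw [h, Matrix.smul_apply, smul_eq_mul]
  exact mul_nonneg (Real.exp_pos _).le (exp_apply_nonneg hB i j)

/-- The derivative of `e^(-cs) P_s f` is `e^(-cs) P_s (A f - c f)`, which is nonpositive because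
`P_s` preserves positivity. -/
lemma heat_mulVec_le {A : Matrix ι ι ℝ} (hA : ∀ i j, i ≠ j → 0 ≤ A i j) {f : ι → ℝ} {c : ℝ}
    (hf : ∀ i, (A *ᵥ f) i ≤ c * f i) {t : ℝ} (ht : 0 ≤ t) (i : ι) :
    (heat A t *ᵥ f) i ≤ Real.exp (c * t) * f i := by
  have hd : ∀ s, HasDerivAt (fun s => Real.exp (-(c * s)) * (heat A s *ᵥ f) i)
      (Real.exp (-(c * s)) * (-c) * (heat A s *ᵥ f) i +
        Real.exp (-(c * s)) * (heat A s *ᵥ (A *ᵥ f)) i) s := by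
    intro s
    refine HasDerivAt.mul ?_ ?_
    · have h := ((hasDerivAt_id s).const_mul c).neg.exp
      simpa using h
    · have h := HasDerivAt.fun_sum (u := univ) (fun j _ =>
        (hasDerivAt_heat_apply A s i j).mul_const (f j))
      rw [Matrix.mulVec_mulVec]
      exact h
  have hanti : AntitoneOn (fun s => Real.exp (-(c * s)) * (heat A s *ᵥ f) i) (Set.Ici 0) := by
    refine antitoneOn_of_deriv_nonpos (convex_Ici 0)
      (fun s _ => (hd s).continuousAt.continuousWithinAt)
      (fun s _ => (hd s).differentiableAt.differentiableWithinAt) ?_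
    intro s hs
    rw [interior_Ici] at hs
    rw [(hd s).deriv, mul_assoc, ← mul_add]
    refine mul_nonpos_of_nonneg_of_nonpos (Real.exp_pos _).le ?_
    simp only [Matrix.mulVec, dotProduct]
    rw [mul_sum, ← sum_add_distrib]
    refine sum_nonpos fun j _ => ?_
    have h1 := heat_nonneg hA (le_of_lt hs) i j
    have h2 := hf j
    simp only [Matrix.mulVec, dotProduct] at h2
    nlinarith
  have h := hanti (Set.mem_Ici.2 le_rfl) (Set.mem_Ici.2 ht) ht
  simp only [mul_zero, neg_zero, Real.exp_zero, heat_zero, Matrix.one_mulVec, one_mul] at h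
  calc (heat A t *ᵥ f) i = Real.exp (c * t) * (Real.exp (-(c * t)) * (heat A t *ᵥ f) i) := by
        rw [← mul_assoc, ← Real.exp_add]; simp
    _ ≤ Real.exp (c * t) * f i := by gcongr

/-- For symmetric `A`, entries of the semigroup are inner products of columns at half time. -/
lemma heat_apply_eq_dotProduct {A : Matrix ι ι ℝ} (hA : A.IsSymm) (t : ℝ) (i j : ι) :
    heat A t i j = (heat A (t / 2)).col i ⬝ᵥ (heat A (t / 2)).col j := by
  conv_lhs => rw [← add_halves t, heat_add, Matrix.mul_apply]
  exact sum_congr rfl fun k _ => by rw [heat_transpose hA]; rfl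

lemma heat_mul_apply_eq_dotProduct {A : Matrix ι ι ℝ} (hA : A.IsSymm) (t : ℝ) (i j : ι) :
    (heat A t * A) i j = (heat A (t / 2)).col i ⬝ᵥ A *ᵥ (heat A (t / 2)).col j := by
  have hcomm : heat A (t / 2) * A = A * heat A (t / 2) :=
    (((Commute.refl A).smul_left (t / 2)).exp_left (𝔸 := Matrix ι ι ℝ)).eq
  have h : heat A t * A = heat A (t / 2) * (A * heat A (t / 2)) := by
    conv_lhs => rw [← add_halves t, heat_add, Matrix.mul_assoc, hcomm]
  rw [h, Matrix.mul_apply]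
  exact sum_congr rfl fun k _ => by rw [heat_transpose hA]; rfl

lemma hasDerivAt_heat_col (A : Matrix ι ι ℝ) (j k : ι) (t : ℝ) :
    HasDerivAt (fun t => (heat A t).col j k) ((A *ᵥ (heat A t).col j) k) t :=
  hasDerivAt_heat_apply' A t k j

lemma hasDerivAt_heat_col_dotProduct_self (A : Matrix ι ι ℝ) (j : ι) (t : ℝ) :
    HasDerivAt (fun t => (heat A t).col j ⬝ᵥ (heat A t).col j)
      (2 * ((heat A t).col j ⬝ᵥ A *ᵥ (heat A t).col j)) t := by
  have h := HasDerivAt.fun_sum (u := univ) (fun k _ =>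
    (hasDerivAt_heat_col A j k t).mul (hasDerivAt_heat_col A j k t))
  refine h.congr_deriv ?_
  rw [dotProduct, mul_sum]
  exact sum_congr rfl fun k _ => by ring

lemma hasDerivAt_heat_col_energy {A : Matrix ι ι ℝ} (hA : A.IsSymm) (j : ι) (t : ℝ) :
    HasDerivAt (fun t => (heat A t).col j ⬝ᵥ A *ᵥ (heat A t).col j)
      (2 * ((A *ᵥ (heat A t).col j) ⬝ᵥ A *ᵥ (heat A t).col j)) t := by
  have h2 : ∀ k, HasDerivAt (fun t => (A *ᵥ (heat A t).col j) k)
      ((A *ᵥ (A *ᵥ (heat A t).col j)) k) t := fun k =>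
    HasDerivAt.fun_sum (u := univ) fun l _ => (hasDerivAt_heat_col A j l t).const_mul (A k l)
  have h := HasDerivAt.fun_sum (u := univ) (fun k _ => (hasDerivAt_heat_col A j k t).mul (h2 k))
  refine h.congr_deriv ?_
  rw [sum_add_distrib, two_mul]
  congr 1
  change (heat A t).col j ⬝ᵥ A *ᵥ (A *ᵥ (heat A t).col j) = _
  rw [Matrix.dotProduct_mulVec, ← Matrix.mulVec_transpose, hA.eq]

/-- The semigroup is invertible. Nonvanishing columns allow negative powers of the square norm
below. -/
lemma heat_col_ne_zero (A : Matrix ι ι ℝ) (t : ℝ) (j : ι) : (heat A t).col j ≠ 0 := by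
  intro h
  have h1 : heat A (-t) * heat A t = 1 := by rw [← heat_add]; simp [heat_zero]
  have h2 := congrFun (congrFun h1 j) j
  rw [Matrix.mul_apply, Matrix.one_apply_eq, sum_eq_zero] at h2
  · exact zero_ne_one h2
  · intro k _
    have := congrFun h k
    rw [Matrix.col_apply] at this
    simp [this]

end Semigroup

/-! ### The Dirichlet truncation and its generator -/

section Truncation

open scoped Matrix

/-- Extension by zero of a vector indexed by `{0, …, N - 1}`. -/
noncomputable def extend (N : ℕ) : (Fin N → ℝ) →ₗ[ℝ] (ℕ → ℝ) where
  toFun v k := if h : k < N then v ⟨k, h⟩ else 0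
  map_add' u v := by ext k; by_cases h : k < N <;> simp [h]
  map_smul' c v := by ext k; by_cases h : k < N <;> simp [h]

lemma extend_fin {N : ℕ} (v : Fin N → ℝ) (i : Fin N) : extend N v i = v i := by
  simp [extend]

lemma extend_of_lt {N : ℕ} (v : Fin N → ℝ) {k : ℕ} (h : k < N) : extend N v k = v ⟨k, h⟩ := by
  simp [extend, h]

lemma extend_of_le {N : ℕ} (v : Fin N → ℝ) {k : ℕ} (h : N ≤ k) : extend N v k = 0 := by
  simp [extend, h]

lemma extend_nonneg {N : ℕ} {v : Fin N → ℝ} (hv : ∀ i, 0 ≤ v i) (k : ℕ) : 0 ≤ extend N v k := by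
  by_cases h : k < N
  · rw [extend_of_lt v h]; exact hv _
  · rw [extend_of_le v (not_lt.1 h)]

/-- The operator `L_λ`, for sequences indexed from `0` instead of `1`. -/
noncomputable def shiftedL (lam : ℝ) : (ℕ → ℝ) →ₗ[ℝ] (ℕ → ℝ) where
  -- At `k = 0` the subtraction `k - 1` truncates to `0`; the term is harmless since `weight lam 0 =
  -- 0`.
  toFun V k := weight lam (k + 1) * (V (k + 1) - V k) - weight lam k * (V k - V (k - 1))
  map_add' u v := by ext k; simp; ring
  map_smul' c v := by ext k; simp; ring

lemma shiftedL_apply (lam : ℝ) (V : ℕ → ℝ) (k : ℕ) : shiftedL lam V k =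
    weight lam (k + 1) * (V (k + 1) - V k) - weight lam k * (V k - V (k - 1)) := rfl

lemma weight_zero (lam : ℝ) : weight lam 0 = 0 := by simp [weight]

lemma weight_succ (lam : ℝ) (k : ℕ) : weight lam (k + 1) = ((k : ℝ) + 1) ^ lam := by
  simp [weight]

lemma weight_nonneg (lam : ℝ) (k : ℕ) : 0 ≤ weight lam k := by
  unfold weight
  split_ifs <;> positivity

lemma opL_succ (lam : ℝ) (U : ℕ → ℝ) (k : ℕ) :
    opL lam U (k + 1) = shiftedL lam (fun j => U (j + 1)) k := by
  rw [shiftedL_apply]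
  cases k with
  | zero => simp [opL, dMinus, dPlus, weight_zero]
  | succ k => simp [opL, dMinus, dPlus]

/-- The Dirichlet form of `L_λ` on `{1, …, N}`. -/
noncomputable def dirForm (lam : ℝ) (N : ℕ) (u v : ℕ → ℝ) : ℝ :=
  ∑ k ∈ range N, ((k : ℝ) + 1) ^ lam * ((u (k + 1) - u k) * (v (k + 1) - v k))

/-- Summation by parts. The boundary term at `N` vanishes for `u` extended by zero, but it carries
the flux needed in Duhamel's formula. -/
lemma sum_mul_shiftedL (lam : ℝ) (N : ℕ) (u V : ℕ → ℝ) :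
    ∑ k ∈ range N, u k * shiftedL lam V k =
      u N * (weight lam N * (V N - V (N - 1))) - dirForm lam N u V := by
  induction N with
  | zero => simp [dirForm, weight_zero]
  | succ N ih =>
    rw [sum_range_succ, ih, dirForm, dirForm, sum_range_succ, shiftedL_apply, weight_succ,
      Nat.add_sub_cancel]
    ring

lemma dirForm_comm (lam : ℝ) (N : ℕ) (u v : ℕ → ℝ) : dirForm lam N u v = dirForm lam N v u :=
  sum_congr rfl fun k _ => by ring

lemma dirForm_self (lam : ℝ) (N : ℕ) (u : ℕ → ℝ) :
    dirForm lam N u u = ∑ k ∈ range N, ((k : ℝ) + 1) ^ lam * (u (k + 1) - u k) ^ 2 :=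
  sum_congr rfl fun k _ => by ring

lemma dirForm_self_nonneg (lam : ℝ) (N : ℕ) (u : ℕ → ℝ) : 0 ≤ dirForm lam N u u := by
  rw [dirForm_self]
  exact sum_nonneg fun k _ => by positivity

lemma dirForm_sq_le (lam : ℝ) (N : ℕ) (u v : ℕ → ℝ) :
    dirForm lam N u v ^ 2 ≤ dirForm lam N u u * dirForm lam N v v := by
  rw [dirForm_self, dirForm_self]
  refine sum_sq_le_sum_mul_sum_of_sq_le_mul _ (fun k _ => by positivity)
    (fun k _ => by positivity) (fun k _ => le_of_eq (by ring))

/-- The matrix of `L_λ` on `{1, …, N}` with Dirichlet condition at `N + 1`. -/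
noncomputable def truncL (lam : ℝ) (N : ℕ) : Matrix (Fin N) (Fin N) ℝ :=
  LinearMap.toMatrix' (LinearMap.funLeft ℝ ℝ (Fin.val : Fin N → ℕ) ∘ₗ shiftedL lam ∘ₗ extend N)

lemma truncL_mulVec (lam : ℝ) {N : ℕ} (v : Fin N → ℝ) (i : Fin N) :
    (truncL lam N *ᵥ v) i = shiftedL lam (extend N v) i := by
  rw [truncL, LinearMap.toMatrix'_mulVec]
  rfl

lemma dotProduct_truncL_mulVec (lam : ℝ) {N : ℕ} (u v : Fin N → ℝ) :
    u ⬝ᵥ truncL lam N *ᵥ v = -dirForm lam N (extend N u) (extend N v) := by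
  have h := sum_mul_shiftedL lam N (extend N u) (extend N v)
  rw [extend_of_le u le_rfl, zero_mul, zero_sub, ← Fin.sum_univ_eq_sum_range
    (fun k => extend N u k * shiftedL lam (extend N v) k)] at h
  rw [← h]
  exact sum_congr rfl fun i _ => by rw [truncL_mulVec, extend_fin]

lemma truncL_apply_eq (lam : ℝ) {N : ℕ} (i j : Fin N) :
    truncL lam N i j = shiftedL lam (extend N (Pi.single j 1)) i := by
  rw [← truncL_mulVec, Matrix.mulVec_single_one, Matrix.col_apply]

lemma truncL_isSymm (lam : ℝ) (N : ℕ) : (truncL lam N).IsSymm := by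
  refine Matrix.IsSymm.ext fun i j => ?_
  have h : ∀ i j : Fin N, truncL lam N i j =
      -dirForm lam N (extend N (Pi.single i 1)) (extend N (Pi.single j 1)) := by
    intro i j
    rw [← dotProduct_truncL_mulVec, single_one_dotProduct, Matrix.mulVec_single_one,
      Matrix.col_apply]
  rw [h, h, dirForm_comm]

lemma truncL_off_diag (lam : ℝ) (N : ℕ) (i j : Fin N) (hij : i ≠ j) : 0 ≤ truncL lam N i j := by
  rw [truncL_apply_eq, shiftedL_apply, extend_fin, Pi.single_eq_of_ne hij]
  have hn : ∀ k, 0 ≤ extend N (Pi.single j 1) k := extend_nonneg fun i => by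
    by_cases h : i = j
    · subst h; simp
    · simp [h]
  have h1 := mul_nonneg (weight_nonneg lam (i + 1)) (hn (i + 1))
  have h2 := mul_nonneg (weight_nonneg lam i) (hn (i - 1))
  linarith

lemma truncL_mulVec_one_le (lam : ℝ) {N : ℕ} (i : Fin N) :
    (truncL lam N *ᵥ fun _ => 1) i ≤ 0 * 1 := by
  rw [truncL_mulVec, shiftedL_apply, extend_fin, extend_of_lt _ (by omega : (i : ℕ) - 1 < N)]
  have h : extend N (fun _ => (1 : ℝ)) (i + 1) ≤ 1 := by
    by_cases h : (i : ℕ) + 1 < N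
    · rw [extend_of_lt _ h]
    · rw [extend_of_le _ (not_lt.1 h)]; norm_num
  have := mul_nonneg (weight_nonneg lam (i + 1)) (sub_nonneg.2 h)
  linarith

/-- The quadratic is a supersolution because `λ < 2`; through `heat_mulVec_le` it controls the
kernel near the cut-off. -/
lemma shiftedL_sq_le {lam : ℝ} (hlam2 : lam < 2) (k : ℕ) :
    shiftedL lam (fun k => ((k : ℝ) + 1) ^ 2) k ≤ 6 * ((k : ℝ) + 1) ^ 2 := by
  rw [shiftedL_apply, weight_succ]
  rcases Nat.eq_zero_or_pos k with rfl | hk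
  · simp [weight_zero]; norm_num
  obtain ⟨n, rfl⟩ : ∃ n, k = n + 1 := ⟨k - 1, by omega⟩
  rw [weight_succ, Nat.add_sub_cancel]
  push_cast
  set y : ℝ := (n : ℝ) + 1 with hy
  have hy1 : 1 ≤ y := by rw [hy]; linarith [(Nat.cast_nonneg n : (0 : ℝ) ≤ n)]
  -- Factoring out `q ≤ 1` reduces to the weight of exponent `2`, for which the difference is `6y² +
  -- 8y + 3 ≤ 6(y+1)²`.
  set q : ℝ := (y + 1) ^ (lam - 2) with hq
  have hq0 : 0 < q := by positivity
  have hq1 : q ≤ 1 := Real.rpow_le_one_of_one_le_of_nonpos (by linarith) (by linarith)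
  have e1 : (y + 1) ^ lam = (y + 1) ^ 2 * q := by
    rw [hq, ← Real.rpow_natCast, ← Real.rpow_add (by linarith)]; congr 1; push_cast; ring
  have e2 : y ^ 2 * q ≤ y ^ lam := by
    have : y ^ lam = y ^ 2 * y ^ (lam - 2) := by
      rw [← Real.rpow_natCast, ← Real.rpow_add (by linarith)]; congr 1; push_cast; ring
    rw [this]
    gcongr
    exact Real.rpow_le_rpow_of_nonpos (by linarith) (by linarith) (by linarith)
  rw [e1]
  have h3 : 0 ≤ (y + 1) ^ 2 - y ^ 2 := by nlinarith
  have h4 := mul_le_mul_of_nonneg_right e2 h3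
  have h5 : (y + 1) ^ 2 * q * ((y + 1 + 1) ^ 2 - (y + 1) ^ 2) - y ^ 2 * q * ((y + 1) ^ 2 - y ^ 2)
      ≤ 6 * (y + 1) ^ 2 := by
    have : (y + 1) ^ 2 * q * ((y + 1 + 1) ^ 2 - (y + 1) ^ 2) -
        y ^ 2 * q * ((y + 1) ^ 2 - y ^ 2) = q * (6 * y ^ 2 + 8 * y + 3) := by ring
    rw [this]
    nlinarith
  linarith

lemma truncL_mulVec_sq_le {lam : ℝ} (hlam2 : lam < 2) {N : ℕ} (i : Fin N) :
    (truncL lam N *ᵥ fun j => ((j : ℝ) + 1) ^ 2) i ≤ 6 * ((i : ℝ) + 1) ^ 2 := by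
  refine le_trans ?_ (shiftedL_sq_le hlam2 i)
  rw [truncL_mulVec, shiftedL_apply, shiftedL_apply, extend_fin,
    extend_of_lt _ (by omega : (i : ℕ) - 1 < N)]
  have h : extend N (fun j => ((j : ℝ) + 1) ^ 2) (i + 1) ≤ (((i + 1 : ℕ) : ℝ) + 1) ^ 2 := by
    by_cases h : (i : ℕ) + 1 < N
    · rw [extend_of_lt _ h]
    · rw [extend_of_le _ (not_lt.1 h)]; positivity
  have := mul_le_mul_of_nonneg_left h (weight_nonneg lam (i + 1))
  simp only
  linarith

/-! ### Decay of the Dirichlet heat kernel, uniform in the truncation -/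

/-- The Dirichlet heat kernel on `{1, …, N}`, as a function of its first variable. -/
noncomputable def kernelCol (lam : ℝ) {N : ℕ} (j : Fin N) (t : ℝ) : Fin N → ℝ :=
  (heat (truncL lam N) t).col j

lemma kernelCol_nonneg (lam : ℝ) {N : ℕ} (j : Fin N) {t : ℝ} (ht : 0 ≤ t) (i : Fin N) :
    0 ≤ kernelCol lam j t i :=
  heat_nonneg (truncL_off_diag lam N) ht i j

lemma kernelCol_comm (lam : ℝ) {N : ℕ} (i j : Fin N) (t : ℝ) :
    kernelCol lam j t i = kernelCol lam i t j :=
  heat_transpose (truncL_isSymm lam N) t i j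

/-- The constant `1` is a supersolution, which bounds row sums; symmetry converts them to column
sums. -/
lemma sum_kernelCol_le_one (lam : ℝ) {N : ℕ} (j : Fin N) {t : ℝ} (ht : 0 ≤ t) :
    ∑ i, kernelCol lam j t i ≤ 1 := by
  have h := heat_mulVec_le (truncL_off_diag lam N) (f := fun _ => 1) (c := 0)
    (truncL_mulVec_one_le lam) ht j
  simp only [zero_mul, Real.exp_zero, mul_one] at h
  refine le_trans (le_of_eq ?_) h
  simp only [Matrix.mulVec, dotProduct, mul_one]
  exact sum_congr rfl fun i _ => kernelCol_comm lam i j t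

lemma sq_mul_kernelCol_le {lam : ℝ} (hlam2 : lam < 2) {N : ℕ} (i j : Fin N) {t : ℝ}
    (ht : 0 ≤ t) :
    ((i : ℝ) + 1) ^ 2 * kernelCol lam j t i ≤ Real.exp (6 * t) * ((j : ℝ) + 1) ^ 2 := by
  have h := heat_mulVec_le (truncL_off_diag lam N) (f := fun j => ((j : ℝ) + 1) ^ 2) (c := 6)
    (truncL_mulVec_sq_le hlam2) ht j
  refine le_trans ?_ h
  simp only [Matrix.mulVec, dotProduct]
  have h2 := single_le_sum (f := fun i : Fin N => heat (truncL lam N) t j i * ((i : ℝ) + 1) ^ 2)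
    (fun i _ => mul_nonneg (heat_nonneg (truncL_off_diag lam N) ht j i) (by positivity))
    (mem_univ i)
  refine le_trans (le_of_eq ?_) h2
  rw [kernelCol_comm, mul_comm]
  rfl

/-- The energy of the Dirichlet heat kernel. -/
noncomputable def kernelEnergy (lam : ℝ) {N : ℕ} (j : Fin N) (t : ℝ) : ℝ :=
  dirForm lam N (extend N (kernelCol lam j t)) (extend N (kernelCol lam j t))

/-- The square norm of the Dirichlet heat kernel. -/
noncomputable def kernelNormSq (lam : ℝ) {N : ℕ} (j : Fin N) (t : ℝ) : ℝ :=
  kernelCol lam j t ⬝ᵥ kernelCol lam j t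

lemma hasDerivAt_kernelNormSq (lam : ℝ) {N : ℕ} (j : Fin N) (t : ℝ) :
    HasDerivAt (kernelNormSq lam j) (-2 * kernelEnergy lam j t) t := by
  refine (hasDerivAt_heat_col_dotProduct_self (truncL lam N) j t).congr_deriv ?_
  rw [dotProduct_truncL_mulVec, kernelEnergy, kernelCol]
  ring

/-- By symmetry of `A` the derivative of the energy is `-2 ‖A p‖₂²`. -/
lemma kernelEnergy_antitone (lam : ℝ) {N : ℕ} (j : Fin N) : Antitone (kernelEnergy lam j) := by
  have hd : ∀ t, HasDerivAt (kernelEnergy lam j)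
      (-(2 * ((truncL lam N *ᵥ kernelCol lam j t) ⬝ᵥ truncL lam N *ᵥ kernelCol lam j t))) t := by
    intro t
    have he : kernelEnergy lam j =
        -fun t => (heat (truncL lam N) t).col j ⬝ᵥ truncL lam N *ᵥ (heat (truncL lam N) t).col j := by
      ext s
      rw [Pi.neg_apply, dotProduct_truncL_mulVec, neg_neg]
      rfl
    rw [he]
    exact (hasDerivAt_heat_col_energy (truncL_isSymm lam N) j t).neg
  refine antitone_of_deriv_nonpos (fun t => (hd t).differentiableAt) fun t => ?_
  rw [(hd t).deriv]
  have : 0 ≤ (truncL lam N *ᵥ kernelCol lam j t) ⬝ᵥ truncL lam N *ᵥ kernelCol lam j t :=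
    sum_nonneg fun i _ => mul_self_nonneg _
  linarith

lemma kernelNormSq_pos (lam : ℝ) {N : ℕ} (j : Fin N) (t : ℝ) : 0 < kernelNormSq lam j t := by
  have h0 : 0 ≤ kernelCol lam j t ⬝ᵥ kernelCol lam j t :=
    sum_nonneg fun i _ => mul_self_nonneg (kernelCol lam j t i)
  refine lt_of_le_of_ne h0 fun h => ?_
  exact heat_col_ne_zero (truncL lam N) t j (dotProduct_self_eq_zero.1 h.symm)

lemma kernelNormSq_eq_sum (lam : ℝ) {N : ℕ} (j : Fin N) (t : ℝ) :
    kernelNormSq lam j t = ∑ k ∈ range N, extend N (kernelCol lam j t) k ^ 2 := by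
  rw [← Fin.sum_univ_eq_sum_range (fun k => extend N (kernelCol lam j t) k ^ 2), kernelNormSq,
    dotProduct]
  exact sum_congr rfl fun i _ => by rw [extend_fin, sq]

lemma kernelNormSq_zero (lam : ℝ) {N : ℕ} (j : Fin N) : kernelNormSq lam j 0 = 1 := by
  rw [kernelNormSq, kernelCol, heat_zero]
  simp [dotProduct, Matrix.one_apply]

lemma nash_kernel {lam : ℝ} (hlam0 : 0 ≤ lam) (hlam2 : lam < 2) {N : ℕ} (j : Fin N) {t : ℝ}
    (ht : 0 ≤ t) :
    nashConst lam * kernelNormSq lam j t ^ (1 + (2 - lam)) ≤ kernelEnergy lam j t := by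
  rw [kernelEnergy, dirForm_self, kernelNormSq_eq_sum]
  refine nash_of_mass_le_one hlam0 hlam2 (extend_nonneg (kernelCol_nonneg lam j ht))
    (fun i hi => extend_of_le _ hi) ?_ ?_
  · rw [← Fin.sum_univ_eq_sum_range (fun k => extend N (kernelCol lam j t) k)]
    simpa only [extend_fin] using sum_kernelCol_le_one lam j ht
  · rw [← kernelNormSq_eq_sum]
    exact kernelNormSq_pos lam j t

/-- With `x = ‖p‖₂²`, Nash gives `x' ≤ -2c x^(1+(2-λ))`, so `x^(-(2-λ))` grows at rate at least
`2(2-λ)c` from its initial value `1`. -/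
lemma kernelNormSq_rpow_le {lam : ℝ} (hlam0 : 0 ≤ lam) (hlam2 : lam < 2) {N : ℕ} (j : Fin N)
    {t : ℝ} (ht : 0 ≤ t) :
    1 + 2 * (2 - lam) * nashConst lam * t ≤ kernelNormSq lam j t ^ (-(2 - lam)) := by
  have hd : ∀ s, HasDerivAt (fun s => kernelNormSq lam j s ^ (-(2 - lam)) -
      2 * (2 - lam) * nashConst lam * s)
      (-2 * kernelEnergy lam j s * (-(2 - lam)) * kernelNormSq lam j s ^ (-(2 - lam) - 1) -
        2 * (2 - lam) * nashConst lam) s := by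
    intro s
    refine ((hasDerivAt_kernelNormSq lam j s).rpow_const
      (Or.inl (kernelNormSq_pos lam j s).ne')).sub ?_
    simpa using (hasDerivAt_id s).const_mul (2 * (2 - lam) * nashConst lam)
  have hm : MonotoneOn (fun s => kernelNormSq lam j s ^ (-(2 - lam)) -
      2 * (2 - lam) * nashConst lam * s) (Set.Ici 0) := by
    refine monotoneOn_of_deriv_nonneg (convex_Ici 0)
      (fun s _ => (hd s).continuousAt.continuousWithinAt)
      (fun s _ => (hd s).differentiableAt.differentiableWithinAt) ?_
    intro s hs
    rw [interior_Ici] at hs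
    rw [(hd s).deriv]
    have hx := kernelNormSq_pos lam j s
    have hn := nash_kernel hlam0 hlam2 j (le_of_lt hs)
    have he : kernelNormSq lam j s ^ (1 + (2 - lam)) * kernelNormSq lam j s ^ (-(2 - lam) - 1)
        = 1 := by
      rw [← Real.rpow_add hx]; ring_nf; simp
    have h1 := mul_le_mul_of_nonneg_right hn
      (Real.rpow_nonneg hx.le (-(2 - lam) - 1))
    rw [mul_assoc, he, mul_one] at h1
    have h2 := mul_le_mul_of_nonneg_left h1 (by linarith : 0 ≤ 2 * (2 - lam))
    linarith
  have h := hm (Set.mem_Ici.2 le_rfl) (Set.mem_Ici.2 ht) ht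
  simp only [kernelNormSq_zero, Real.one_rpow, mul_zero, sub_zero] at h
  linarith

/-- The rate constant in the on-diagonal decay of the heat kernel. -/
noncomputable def rateConst (lam : ℝ) : ℝ := min 1 (2 * (2 - lam) * nashConst lam)

lemma rateConst_pos {lam : ℝ} (hlam2 : lam < 2) : 0 < rateConst lam :=
  lt_min one_pos (mul_pos (by linarith) (nashConst_pos hlam2))

lemma alpha_pos {lam : ℝ} (hlam2 : lam < 2) : 0 < alpha lam :=
  one_div_pos.2 (by linarith)

lemma kernelNormSq_le {lam : ℝ} (hlam0 : 0 ≤ lam) (hlam2 : lam < 2) {N : ℕ} (j : Fin N)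
    {t : ℝ} (ht : 0 ≤ t) :
    kernelNormSq lam j t ≤ rateConst lam ^ (-alpha lam) * (1 + t) ^ (-alpha lam) := by
  have h := kernelNormSq_rpow_le hlam0 hlam2 j ht
  have hx := kernelNormSq_pos lam j t
  have hr := rateConst_pos hlam2
  -- The minimum with `1` in `rateConst` merges the bounds for small and large `t` into a multiple
  -- of `1 + t`.
  have h1 : rateConst lam * (1 + t) ≤ kernelNormSq lam j t ^ (-(2 - lam)) := by
    refine le_trans ?_ h
    have a1 : rateConst lam ≤ 1 := min_le_left _ _
    have a2 : rateConst lam ≤ 2 * (2 - lam) * nashConst lam := min_le_right _ _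
    have := mul_le_mul_of_nonneg_right a2 ht
    linarith
  have h2 := Real.rpow_le_rpow_of_nonpos (by positivity) h1
    (neg_nonpos.2 (alpha_pos hlam2).le)
  rw [← Real.rpow_mul hx.le, Real.mul_rpow hr.le (by linarith)] at h2
  have e : -(2 - lam) * -alpha lam = 1 := by
    rw [alpha]; field_simp [(by linarith : (2 : ℝ) - lam ≠ 0)]
  rwa [e, Real.rpow_one] at h2

/-- On `[t/2, t]` the square norm drops by `t E(ξ)` for some `ξ`, and `E(ξ) ≥ E(t)` by monotonicity.
-/
lemma mul_kernelEnergy_le (lam : ℝ) {N : ℕ} (j : Fin N) {t : ℝ} (ht : 0 < t) :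
    t * kernelEnergy lam j t ≤ kernelNormSq lam j (t / 2) := by
  obtain ⟨ξ, hξ, he⟩ := exists_hasDerivAt_eq_slope (kernelNormSq lam j)
    (fun s => -2 * kernelEnergy lam j s) (by linarith : t / 2 < t)
    (fun s _ => (hasDerivAt_kernelNormSq lam j s).continuousAt.continuousWithinAt)
    (fun s _ => hasDerivAt_kernelNormSq lam j s)
  rw [eq_div_iff (by linarith)] at he
  have h1 := kernelEnergy_antitone lam j hξ.2.le
  have h2 := kernelNormSq_pos lam j t
  nlinarith

/-- The constant in the energy decay of the heat kernel. -/
noncomputable def decayConst (lam : ℝ) : ℝ := rateConst lam ^ (-alpha lam) * 2 ^ (alpha lam)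

lemma decayConst_pos {lam : ℝ} (hlam2 : lam < 2) : 0 < decayConst lam := by
  have := rateConst_pos hlam2
  unfold decayConst
  positivity

lemma one_add_half_rpow_le {a t : ℝ} (ha : 0 ≤ a) (ht : 0 ≤ t) :
    (1 + t / 2) ^ (-a) ≤ 2 ^ a * (1 + t) ^ (-a) := by
  have h := Real.rpow_le_rpow_of_nonpos (by positivity)
    (by linarith : (1 + t) / 2 ≤ 1 + t / 2) (neg_nonpos.2 ha)
  refine h.trans (le_of_eq ?_)
  rw [Real.div_rpow (by positivity) (by norm_num), Real.rpow_neg (by norm_num : (0 : ℝ) ≤ 2)]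
  field_simp

lemma kernelNormSq_half_le {lam : ℝ} (hlam0 : 0 ≤ lam) (hlam2 : lam < 2) {N : ℕ} (j : Fin N)
    {t : ℝ} (ht : 0 ≤ t) :
    kernelNormSq lam j (t / 2) ≤ decayConst lam * (1 + t) ^ (-alpha lam) := by
  refine (kernelNormSq_le hlam0 hlam2 j (by positivity)).trans ?_
  rw [decayConst, mul_assoc]
  have := rateConst_pos hlam2
  exact mul_le_mul_of_nonneg_left (one_add_half_rpow_le (alpha_pos hlam2).le ht) (by positivity)

lemma kernelEnergy_le {lam : ℝ} (hlam0 : 0 ≤ lam) (hlam2 : lam < 2) {N : ℕ} (j : Fin N)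
    {t : ℝ} (ht : 0 < t) :
    kernelEnergy lam j t ≤ decayConst lam * t ^ (-1 - alpha lam) := by
  have h1 := (mul_kernelEnergy_le lam j ht).trans (kernelNormSq_half_le hlam0 hlam2 j ht.le)
  have h2 : (1 + t) ^ (-alpha lam) ≤ t ^ (-alpha lam) :=
    Real.rpow_le_rpow_of_nonpos ht (by linarith) (neg_nonpos.2 (alpha_pos hlam2).le)
  have h3 : t ^ (-1 - alpha lam) = t ^ (-alpha lam) / t := by
    rw [show -1 - alpha lam = -alpha lam - 1 by ring, Real.rpow_sub ht, Real.rpow_one]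
  rw [h3, ← mul_div_assoc, le_div_iff₀ ht, mul_comm]
  exact h1.trans (mul_le_mul_of_nonneg_left h2 (decayConst_pos hlam2).le)

lemma kernelCol_le {lam : ℝ} (hlam0 : 0 ≤ lam) (hlam2 : lam < 2) {N : ℕ} (i j : Fin N)
    {t : ℝ} (ht : 0 ≤ t) :
    kernelCol lam j t i ≤ decayConst lam * (1 + t) ^ (-alpha lam) := by
  have h : kernelCol lam j t i = kernelCol lam i (t / 2) ⬝ᵥ kernelCol lam j (t / 2) :=
    heat_apply_eq_dotProduct (truncL_isSymm lam N) t i j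
  have h1 : kernelCol lam i (t / 2) ⬝ᵥ kernelCol lam j (t / 2) ≤
      (kernelNormSq lam i (t / 2) + kernelNormSq lam j (t / 2)) / 2 := by
    rw [kernelNormSq, kernelNormSq, dotProduct, dotProduct, dotProduct, ← sum_add_distrib,
      sum_div]
    refine sum_le_sum fun k _ => ?_
    nlinarith [sq_nonneg (kernelCol lam i (t / 2) k - kernelCol lam j (t / 2) k)]
  have := kernelNormSq_half_le hlam0 hlam2 i ht
  have := kernelNormSq_half_le hlam0 hlam2 j ht
  linarith

/-- The derivative is minus the Dirichlet product of two columns at time `t / 2`, so Cauchy–Schwarz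
reduces it to energies. -/
lemma exists_hasDerivAt_kernelCol {lam : ℝ} (hlam0 : 0 ≤ lam) (hlam2 : lam < 2) {N : ℕ}
    (i j : Fin N) {t : ℝ} (ht : 0 < t) :
    ∃ d : ℝ, HasDerivAt (fun t => kernelCol lam j t i) d t ∧
      |d| ≤ decayConst lam * 2 ^ (1 + alpha lam) * t ^ (-1 - alpha lam) := by
  refine ⟨_, hasDerivAt_heat_apply (truncL lam N) t i j, ?_⟩
  rw [heat_mul_apply_eq_dotProduct (truncL_isSymm lam N), dotProduct_truncL_mulVec, abs_neg]
  have hC : 0 ≤ decayConst lam * 2 ^ (1 + alpha lam) * t ^ (-1 - alpha lam) := by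
    have := decayConst_pos hlam2
    positivity
  have e : decayConst lam * (t / 2) ^ (-1 - alpha lam) =
      decayConst lam * 2 ^ (1 + alpha lam) * t ^ (-1 - alpha lam) := by
    rw [Real.div_rpow ht.le (by norm_num), show -1 - alpha lam = -(1 + alpha lam) by ring,
      Real.rpow_neg (by norm_num : (0 : ℝ) ≤ 2)]
    field_simp
  refine abs_le_of_sq_le_sq ?_ hC
  refine (dirForm_sq_le _ _ _ _).trans ?_
  rw [sq, ← e]
  have h1 := kernelEnergy_le hlam0 hlam2 i (half_pos ht)
  have h2 := kernelEnergy_le hlam0 hlam2 j (half_pos ht)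
  exact mul_le_mul h1 h2 (dirForm_self_nonneg _ _ _) (by rw [e]; exact hC)

lemma sq_sub_kernelCol_le {lam : ℝ} (hlam0 : 0 ≤ lam) (hlam2 : lam < 2) {N : ℕ}
    (i₁ i₂ j : Fin N) (hi : (i₁ : ℕ) ≤ i₂) {t : ℝ} (ht : 0 < t) :
    (kernelCol lam j t i₂ - kernelCol lam j t i₁) ^ 2 ≤
      (∑ k ∈ Ico (i₁ : ℕ) i₂, ((k : ℝ) + 1) ^ (-lam)) *
        (decayConst lam * t ^ (-1 - alpha lam)) := by
  set V := extend N (kernelCol lam j t) with hV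
  have e : kernelCol lam j t i₂ - kernelCol lam j t i₁ =
      ∑ k ∈ Ico (i₁ : ℕ) i₂, (V (k + 1) - V k) := by
    rw [sum_Ico_sub V hi, hV, extend_fin, extend_fin]
  rw [e]
  refine (sum_sq_le_sum_mul_sum_of_sq_le_mul (Ico (i₁ : ℕ) i₂)
    (f := fun k => ((k : ℝ) + 1) ^ (-lam))
    (g := fun k => ((k : ℝ) + 1) ^ lam * (V (k + 1) - V k) ^ 2)
    (fun k _ => by positivity) (fun k _ => by positivity) (fun k _ => ?_)).trans ?_
  · rw [← mul_assoc, ← Real.rpow_add (by positivity)]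
    simp
  · refine mul_le_mul_of_nonneg_left ?_ (sum_nonneg fun k _ => by positivity)
    refine le_trans ?_ (kernelEnergy_le hlam0 hlam2 j ht)
    rw [kernelEnergy, dirForm_self]
    refine sum_le_sum_of_subset_of_nonneg (fun k hk => ?_) fun k _ _ => by positivity
    rw [mem_Ico] at hk
    rw [mem_range]
    omega

end Truncation

/-! ### Comparison of a solution with its truncations -/

section Duhamel

open MeasureTheory Filter Topology
open scoped Matrix

/-- Green's identity: the Dirichlet forms cancel, leaving the exchange between the last site and the
first one outside. -/
lemma sum_mul_shiftedL_sub (lam : ℝ) {n : ℕ} (p : Fin (n + 1) → ℝ) (V : ℕ → ℝ) :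
    ∑ k : Fin (n + 1), (-(truncL lam (n + 1) *ᵥ p) k * V k + p k * shiftedL lam V k) =
      weight lam (n + 1) * p (Fin.last n) * V (n + 1) := by
  have h1 := sum_mul_shiftedL lam (n + 1) (extend (n + 1) p) V
  have h2 := sum_mul_shiftedL lam (n + 1) V (extend (n + 1) p)
  rw [extend_of_le p le_rfl] at h1 h2
  rw [dirForm_comm, Nat.add_sub_cancel, extend_of_lt p (Nat.lt_succ_self n)] at h2
  rw [← Fin.sum_univ_eq_sum_range (fun k => extend (n + 1) p k * shiftedL lam V k)] at h1
  rw [← Fin.sum_univ_eq_sum_range (fun k => V k * shiftedL lam (extend (n + 1) p) k)] at h2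
  have h3 : ∑ k : Fin (n + 1), (-(truncL lam (n + 1) *ᵥ p) k * V k + p k * shiftedL lam V k) =
      ∑ k : Fin (n + 1), extend (n + 1) p k * shiftedL lam V k -
        ∑ k : Fin (n + 1), V k * shiftedL lam (extend (n + 1) p) k := by
    rw [← sum_sub_distrib]
    refine sum_congr rfl fun k _ => ?_
    rw [truncL_mulVec, extend_fin]
    ring
  rw [h3, h1, h2, Fin.last]
  ring

variable {lam mu : ℝ} {T : EReal} {U₀ : ℕ → ℝ} {U : ℝ → ℕ → ℝ}

lemma Icc_subset_timeInterval {t : ℝ} (ht : t ∈ timeInterval T) :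
    Set.Icc 0 t ⊆ timeInterval T := fun _ hs =>
  ⟨hs.1, lt_of_le_of_lt (EReal.coe_le_coe_iff.2 hs.2) ht.2⟩

lemma IsSolution.continuousOn_shiftedL (hU : IsSolution lam mu T U₀ U) (k : ℕ) :
    ContinuousOn (fun s => shiftedL lam (fun j => U s (j + 1)) k) (timeInterval T) := by
  have h : ∀ j, ContinuousOn (fun s => U s (j + 1)) (timeInterval T) := fun j =>
    hU.continuousOn (j + 1) (by omega)
  simp only [shiftedL_apply]
  exact (continuousOn_const.mul ((h _).sub (h _))).sub
    (continuousOn_const.mul ((h _).sub (h _)))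

lemma IsSolution.hasDerivAt (hU : IsSolution lam mu T U₀ U) {t : ℝ} (ht : t ∈ timeInterval T)
    (k : ℕ) {s : ℝ} (hs : s ∈ Set.Ioo 0 t) :
    HasDerivAt (fun s => U s (k + 1)) (shiftedL lam (fun j => U s (j + 1)) k) s := by
  have hc : ContinuousOn (fun s => shiftedL lam (fun j => U s (j + 1)) k) (Set.Icc 0 t) :=
    (hU.continuousOn_shiftedL k).mono (Icc_subset_timeInterval ht)
  have hnhds : Set.Ioo 0 t ∈ 𝓝 s := isOpen_Ioo.mem_nhds hs
  have hi := intervalIntegral.integral_hasDerivAt_right (a := 0) (b := s)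
    (f := fun s => shiftedL lam (fun j => U s (j + 1)) k)
    ((hc.mono (Set.Icc_subset_Icc_right hs.2.le)).intervalIntegrable_of_Icc hs.1.le)
    ((hc.mono Set.Ioo_subset_Icc_self).stronglyMeasurableAtFilter isOpen_Ioo s hs)
    (hc.continuousAt (mem_of_superset hnhds Set.Ioo_subset_Icc_self))
  refine (hi.const_add (U₀ (k + 1))).congr_of_eventuallyEq ?_
  filter_upwards [hnhds] with r hr
  rw [hU.integral_eq (k + 1) (by omega) r
    (Icc_subset_timeInterval ht (Set.Ioo_subset_Icc_self hr))]
  simp only [opL_succ]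

lemma zero_mem_timeInterval {t : ℝ} (ht : t ∈ timeInterval T) : (0 : ℝ) ∈ timeInterval T :=
  Icc_subset_timeInterval ht ⟨le_rfl, ht.1⟩

lemma IsSolution.apply_zero (hU : IsSolution lam mu T U₀ U) {t : ℝ} (ht : t ∈ timeInterval T)
    (k : ℕ) : U 0 (k + 1) = U₀ (k + 1) := by
  rw [hU.integral_eq (k + 1) (by omega) 0 (zero_mem_timeInterval ht)]
  simp

lemma hasDerivAt_kernelCol_sub (lam : ℝ) {N : ℕ} (j k : Fin N) (t s : ℝ) :
    HasDerivAt (fun s => kernelCol lam j (t - s) k)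
      (-(truncL lam N *ᵥ kernelCol lam j (t - s)) k) s := by
  have h := (hasDerivAt_heat_col (truncL lam N) j k (t - s)).comp_const_sub t s
  exact h

lemma continuous_kernelCol_sub (lam : ℝ) {N : ℕ} (j k : Fin N) (t : ℝ) :
    Continuous fun s => kernelCol lam j (t - s) k :=
  continuous_iff_continuousAt.2 fun s => (hasDerivAt_kernelCol_sub lam j k t s).continuousAt

/-- Duhamel's formula comparing a solution with the truncated Dirichlet problem. -/
lemma IsSolution.sub_sum_kernelCol_eq (hU : IsSolution lam mu T U₀ U) {t : ℝ}
    (ht : t ∈ timeInterval T) {n : ℕ} (j : Fin (n + 1)) :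
    U t (j + 1) - ∑ k : Fin (n + 1), kernelCol lam j t k * U₀ (k + 1) =
      ∫ s in (0 : ℝ)..t,
        weight lam (n + 1) * kernelCol lam j (t - s) (Fin.last n) * U s (n + 2) := by
  have hcU : ∀ k, ContinuousOn (fun s => U s (k + 1)) (Set.Icc 0 t) := fun k =>
    (hU.continuousOn (k + 1) (by omega)).mono (Icc_subset_timeInterval ht)
  have hcp : ∀ k : Fin (n + 1), ContinuousOn (fun s => kernelCol lam j (t - s) k) (Set.Icc 0 t) :=
    fun k => (continuous_kernelCol_sub lam j k t).continuousOn
  -- The sum interpolates between the truncated solution at `s = 0` and, as the kernel at time `0`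
  -- is the identity, `U t (j + 1)` at `s = t`.
  have h := intervalIntegral.integral_eq_sub_of_hasDerivAt_of_le ht.1
    (f := fun s => ∑ k : Fin (n + 1), kernelCol lam j (t - s) k * U s (k + 1))
    (f' := fun s => weight lam (n + 1) * kernelCol lam j (t - s) (Fin.last n) * U s (n + 2))
    (continuousOn_finsetSum _ fun k _ => (hcp k).mul (hcU k))
    (fun s hs => by
      have hd := HasDerivAt.fun_sum (u := univ) (fun (k : Fin (n + 1)) _ =>
        (hasDerivAt_kernelCol_sub lam j k t s).mul (hU.hasDerivAt ht k hs))
      refine hd.congr_deriv ?_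
      exact sum_mul_shiftedL_sub lam (kernelCol lam j (t - s)) fun k => U s (k + 1))
    (((continuousOn_const.mul (hcp (Fin.last n))).mul (hcU (n + 1))).intervalIntegrable_of_Icc ht.1)
  rw [h]
  simp only [sub_self, sub_zero]
  congr 1
  · rw [sum_eq_single j]
    · simp [kernelCol, heat_zero]
    · intro k _ hk
      simp [kernelCol, heat_zero, hk]
    · simp
  · exact sum_congr rfl fun k _ => by rw [hU.apply_zero ht]

/-- The weight at the cut-off is at most `(n+1)²`, exactly what `sq_mul_kernelCol_le` absorbs. -/
lemma IsSolution.abs_sub_sum_kernelCol_le (hU : IsSolution lam mu T U₀ U) (hlam2 : lam < 2)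
    {t : ℝ} (ht : t ∈ timeInterval T) {n : ℕ} (j : Fin (n + 1)) :
    |U t (j + 1) - ∑ k : Fin (n + 1), kernelCol lam j t k * U₀ (k + 1)| ≤
      Real.exp (6 * t) * ((j : ℝ) + 1) ^ 2 * ∫ s in (0 : ℝ)..t, |U s (n + 2)| := by
  have hcU : ContinuousOn (fun s => U s (n + 2)) (Set.Icc 0 t) :=
    (hU.continuousOn (n + 2) (by omega)).mono (Icc_subset_timeInterval ht)
  rw [hU.sub_sum_kernelCol_eq ht j, ← intervalIntegral.integral_const_mul]
  rw [← Real.norm_eq_abs]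
  refine intervalIntegral.norm_integral_le_of_norm_le ht.1 (ae_of_all _ fun s hs => ?_)
    (ContinuousOn.intervalIntegrable_of_Icc (μ := volume) ht.1 (continuousOn_const.mul hcU.abs))
  have hts : 0 ≤ t - s := sub_nonneg.2 hs.2
  rw [Real.norm_eq_abs, abs_mul]
  refine mul_le_mul_of_nonneg_right ?_ (abs_nonneg _)
  have hp := kernelCol_nonneg lam j hts (Fin.last n)
  rw [abs_of_nonneg (mul_nonneg (weight_nonneg _ _) hp), weight_succ]
  have hw : ((n : ℝ) + 1) ^ lam ≤ ((n : ℝ) + 1) ^ 2 := by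
    rw [← Real.rpow_natCast]
    refine Real.rpow_le_rpow_of_exponent_le ?_ (by exact_mod_cast hlam2.le)
    linarith [(Nat.cast_nonneg n : (0 : ℝ) ≤ n)]
  refine (mul_le_mul_of_nonneg_right hw hp).trans ?_
  have h := sq_mul_kernelCol_le hlam2 (Fin.last n) j hts
  rw [Fin.val_last] at h
  refine h.trans (mul_le_mul_of_nonneg_right (Real.exp_le_exp.2 ?_) (by positivity))
  linarith [hs.1.le]

lemma MemX.summable_abs {V : ℕ → ℝ} (hV : MemX mu V) (hmu : 0 ≤ mu) :
    Summable fun k => |V (k + 1)| := by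
  refine Summable.of_nonneg_of_le (fun k => abs_nonneg _) (fun k => ?_) hV
  refine le_mul_of_one_le_left (abs_nonneg _) (Real.one_le_rpow ?_ hmu)
  push_cast
  linarith [(Nat.cast_nonneg k : (0 : ℝ) ≤ k)]

lemma MemX.sum_abs_le_normX {V : ℕ → ℝ} (hV : MemX mu V) (hmu : 0 ≤ mu) (s : Finset ℕ) :
    ∑ k ∈ s, |V (k + 1)| ≤ normX mu V := by
  refine le_trans (sum_le_sum fun k _ => ?_)
    (hV.sum_le_tsum s fun k _ => mul_nonneg (by positivity) (abs_nonneg _))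
  refine le_mul_of_one_le_left (abs_nonneg _) (Real.one_le_rpow ?_ hmu)
  push_cast
  linarith [(Nat.cast_nonneg k : (0 : ℝ) ≤ k)]

/-- The partial sums are integrals of partial `ℓ¹` sums, bounded almost everywhere by the local
bound on the `X_μ` norm. Summability forces the boundary term to `0`. -/
lemma IsSolution.summable_integral_abs (hU : IsSolution lam mu T U₀ U) (hmu : 0 ≤ mu)
    {t : ℝ} (ht : t ∈ timeInterval T) :
    Summable fun n : ℕ => ∫ s in (0 : ℝ)..t, |U s (n + 1)| := by
  have hcU : ∀ k, ContinuousOn (fun s => |U s (k + 1)|) (Set.Icc 0 t) := fun k =>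
    ((hU.continuousOn (k + 1) (by omega)).mono (Icc_subset_timeInterval ht)).abs
  obtain ⟨B, hB⟩ : ∃ B : ℝ, ∀ᵐ s ∂volume.restrict (Set.Icc 0 t), ‖normX mu (U s)‖ ≤ B := by
    have h1 := (hU.locallyBounded t ht).eLpNorm_lt_top
    rw [eLpNorm_exponent_top] at h1
    refine ⟨(eLpNormEssSup (fun t => normX mu (U t)) (volume.restrict (Set.Icc 0 t))).toReal, ?_⟩
    filter_upwards [ae_le_eLpNormEssSup (f := fun t => normX mu (U t))
      (μ := volume.restrict (Set.Icc 0 t))] with s hs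
    have := ENNReal.toReal_mono h1.ne hs
    rwa [toReal_enorm] at this
  rw [ae_restrict_iff' measurableSet_Icc] at hB
  refine summable_of_sum_range_le (c := B * |t - 0|)
    (fun n => intervalIntegral.integral_nonneg ht.1 fun s _ => abs_nonneg _) fun M => ?_
  rw [← intervalIntegral.integral_finsetSum fun k _ =>
    (hcU k).intervalIntegrable_of_Icc ht.1]
  refine (Real.le_norm_self _).trans (intervalIntegral.norm_integral_le_of_norm_le_const_ae ?_)
  filter_upwards [hB] with s hs hs'
  rw [Set.uIoc_of_le ht.1] at hs'
  have hs'' : s ∈ Set.Icc 0 t := Set.Ioc_subset_Icc_self hs'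
  rw [Real.norm_of_nonneg (sum_nonneg fun k _ => abs_nonneg _)]
  exact ((hU.memX s (Icc_subset_timeInterval ht hs'')).sum_abs_le_normX hmu _).trans
    ((le_abs_self _).trans (hs hs''))

/-- The solution of the truncated Dirichlet problem, extended by zero. -/
noncomputable def truncSol (lam : ℝ) (U₀ : ℕ → ℝ) (n : ℕ) (t : ℝ) : ℕ → ℝ :=
  extend (n + 1) fun i => ∑ k : Fin (n + 1), kernelCol lam i t k * U₀ (k + 1)

lemma IsSolution.tendsto_truncSol (hU : IsSolution lam mu T U₀ U) (hlam2 : lam < 2)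
    (hmu : 0 ≤ mu) {t : ℝ} (ht : t ∈ timeInterval T) (j : ℕ) :
    Tendsto (fun n => truncSol lam U₀ n t j) atTop (𝓝 (U t (j + 1))) := by
  have h0 : Tendsto (fun n : ℕ => Real.exp (6 * t) * ((j : ℝ) + 1) ^ 2 *
      ∫ s in (0 : ℝ)..t, |U s (n + 2)|) atTop (𝓝 0) := by
    have h := ((hU.summable_integral_abs hmu ht).tendsto_atTop_zero.comp
      (tendsto_add_atTop_nat 1)).const_mul (Real.exp (6 * t) * ((j : ℝ) + 1) ^ 2)
    rw [mul_zero] at h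
    exact h
  rw [tendsto_iff_norm_sub_tendsto_zero]
  refine squeeze_zero' (Eventually.of_forall fun n => norm_nonneg _) ?_ h0
  filter_upwards [eventually_ge_atTop j] with n hn
  have h := hU.abs_sub_sum_kernelCol_le hlam2 ht (⟨j, by omega⟩ : Fin (n + 1))
  rw [truncSol, extend_of_lt _ (by omega : j < n + 1), Real.norm_eq_abs, abs_sub_comm]
  exact h

end Duhamel

/-! ### The profiles `θ_λ` and `ω_λ` -/

section Profiles

lemma hasDerivAt_theta (lam : ℝ) {x : ℝ} (hx : 0 < x) :
    HasDerivAt (theta lam) (x ^ (-lam)) x := by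
  by_cases h : lam = 1
  · subst h
    have e : theta 1 = Real.log := by ext x; simp [theta]
    rw [e, Real.rpow_neg_one]
    exact Real.hasDerivAt_log hx.ne'
  · have e : theta lam = fun x => 1 / (1 - lam) * x ^ (1 - lam) := by ext x; simp [theta, h]
    have h1 : 1 - lam ≠ 0 := sub_ne_zero.2 (Ne.symm h)
    rw [e]
    refine ((Real.hasDerivAt_rpow_const (Or.inl hx.ne')).const_mul _).congr_deriv ?_
    rw [show 1 - lam - 1 = -lam by ring]
    field_simp

lemma continuousOn_theta (lam : ℝ) : ContinuousOn (theta lam) (Set.Ioi 0) := fun _ hx =>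
  (hasDerivAt_theta lam hx).continuousAt.continuousWithinAt

lemma theta_pos {lam x : ℝ} (hlam : lam < 1) (hx : 0 < x) : 0 < theta lam x := by
  have : 0 < 1 - lam := by linarith
  rw [theta, if_neg hlam.ne]
  positivity

lemma theta_mul_sub (lam : ℝ) {c x y : ℝ} (hc : 0 < c) (hx : 0 < x) (hy : 0 < y) :
    theta lam (c * x) - theta lam (c * y) = c ^ (1 - lam) * (theta lam x - theta lam y) := by
  by_cases h : lam = 1
  · subst h
    simp only [theta, if_true, sub_self, Real.rpow_zero, one_mul]
    rw [Real.log_mul hc.ne' hx.ne', Real.log_mul hc.ne' hy.ne']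
    ring
  · simp only [theta, h, if_false]
    rw [Real.mul_rpow hc.le hx.le, Real.mul_rpow hc.le hy.le]
    ring

/-- In the mean value theorem `ξ < x + 1 ≤ 2x`, and `2^(-λ) ≥ 1/4`; this is the source of the factor
`4`. -/
lemma rpow_neg_le_theta_sub {lam : ℝ} (hlam0 : 0 ≤ lam) (hlam2 : lam < 2) {x : ℝ} (hx : 1 ≤ x) :
    x ^ (-lam) ≤ 4 * (theta lam (x + 1) - theta lam x) := by
  obtain ⟨ξ, hξ, he⟩ := exists_hasDerivAt_eq_slope (theta lam) (fun y => y ^ (-lam))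
    (by linarith : x < x + 1)
    (fun y hy => (hasDerivAt_theta lam (by linarith [hy.1])).continuousAt.continuousWithinAt)
    (fun y hy => hasDerivAt_theta lam (by linarith [hy.1]))
  rw [add_sub_cancel_left, div_one] at he
  rw [← he]
  have hξ0 : 0 < ξ := by linarith [hξ.1]
  have h1 : (2 * x) ^ (-lam) ≤ ξ ^ (-lam) :=
    Real.rpow_le_rpow_of_nonpos hξ0 (by linarith [hξ.2]) (by linarith)
  rw [Real.mul_rpow (by norm_num) (by linarith)] at h1
  have h2 : (2 : ℝ) ^ (-(2 : ℝ)) ≤ 2 ^ (-lam) :=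
    Real.rpow_le_rpow_of_exponent_le (by norm_num) (by linarith)
  have h3 : (2 : ℝ) ^ (-(2 : ℝ)) = 1 / 4 := by
    rw [Real.rpow_neg (by norm_num)]; norm_num
  rw [h3] at h2
  have h4 : 0 ≤ x ^ (-lam) := Real.rpow_nonneg (by linarith) _
  nlinarith

lemma sum_rpow_neg_le_theta_sub {lam : ℝ} (hlam0 : 0 ≤ lam) (hlam2 : lam < 2) {a b : ℕ}
    (hab : a ≤ b) :
    ∑ k ∈ Ico a b, ((k : ℝ) + 1) ^ (-lam) ≤ 4 * (theta lam (b + 1) - theta lam (a + 1)) := by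
  rw [← sum_Ico_sub (fun k : ℕ => theta lam ((k : ℝ) + 1)) hab, mul_sum]
  refine sum_le_sum fun k _ => ?_
  push_cast
  exact rpow_neg_le_theta_sub hlam0 hlam2
    (by linarith [(Nat.cast_nonneg k : (0 : ℝ) ≤ k)])

/-- The function `ω_λ` without absolute values. -/
noncomputable def signedOmega (lam r : ℝ) : ℝ :=
  if lam = 1 then Real.log (2 * r - 1)
  else 2 / (1 - alpha lam) * ((r - 1 / 2) ^ ((1 - alpha lam) / 2) -
    (1 / 2 : ℝ) ^ ((1 - alpha lam) / 2))

lemma alpha_eq_one_iff {lam : ℝ} (hlam2 : lam < 2) : alpha lam = 1 ↔ lam = 1 := by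
  rw [alpha, div_eq_one_iff_eq (by linarith)]
  constructor <;> intro h <;> linarith

/-- One formula covers `λ = 1` too, since then `α = 1`. -/
lemma hasDerivAt_signedOmega {lam : ℝ} (hlam2 : lam < 2) {r : ℝ} (hr : 1 ≤ r) :
    HasDerivAt (signedOmega lam) ((r - 1 / 2) ^ (-((1 + alpha lam) / 2))) r := by
  have hr2 : 0 < r - 1 / 2 := by linarith
  by_cases h : lam = 1
  · have ha := (alpha_eq_one_iff hlam2).2 h
    have e : signedOmega lam = fun r => Real.log (2 * r - 1) := by ext; simp [signedOmega, h]
    rw [e, ha]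
    have hd : HasDerivAt (fun r : ℝ => 2 * r - 1) (2 * 1) r :=
      ((hasDerivAt_id r).const_mul 2).sub_const 1
    refine (hd.log (by linarith)).congr_deriv ?_
    rw [show -((1 + 1 : ℝ) / 2) = -1 by norm_num, Real.rpow_neg_one]
    have : 2 * r - 1 ≠ 0 := by linarith
    field_simp
  · have ha : 1 - alpha lam ≠ 0 := sub_ne_zero.2 (Ne.symm (mt (alpha_eq_one_iff hlam2).1 h))
    have e : signedOmega lam = fun r => 2 / (1 - alpha lam) *
        ((r - 1 / 2) ^ ((1 - alpha lam) / 2) - (1 / 2 : ℝ) ^ ((1 - alpha lam) / 2)) := by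
      ext; simp [signedOmega, h]
    rw [e]
    have hd : HasDerivAt (fun r : ℝ => r - 1 / 2) 1 r := (hasDerivAt_id r).sub_const _
    refine (((hd.rpow_const (Or.inl hr2.ne')).sub_const _).const_mul _).congr_deriv ?_
    rw [show (1 - alpha lam) / 2 - 1 = -((1 + alpha lam) / 2) by ring]
    field_simp

lemma signedOmega_one (lam : ℝ) : signedOmega lam 1 = 0 := by
  unfold signedOmega
  split_ifs <;> norm_num

lemma signedOmega_nonneg {lam : ℝ} (hlam2 : lam < 2) {r : ℝ} (hr : 1 ≤ r) :
    0 ≤ signedOmega lam r := by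
  have hm : MonotoneOn (signedOmega lam) (Set.Ici 1) := by
    refine monotoneOn_of_deriv_nonneg (convex_Ici 1)
      (fun s hs => (hasDerivAt_signedOmega hlam2 hs).continuousAt.continuousWithinAt) ?_ ?_
    all_goals
      intro s hs
      rw [interior_Ici] at hs
      have hd := hasDerivAt_signedOmega hlam2 (le_of_lt hs)
    · exact hd.differentiableAt.differentiableWithinAt
    · rw [hd.deriv]
      have : (1 : ℝ) < s := hs
      exact Real.rpow_nonneg (by linarith) _
  have h := hm (Set.mem_Ici.2 le_rfl) (Set.mem_Ici.2 hr) hr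
  rwa [signedOmega_one] at h

lemma omega_eq_signedOmega {lam : ℝ} (hlam2 : lam < 2) {r : ℝ} (hr : 1 ≤ r) :
    omega lam r = signedOmega lam r := by
  have h := signedOmega_nonneg hlam2 hr
  unfold omega
  by_cases hl : lam = 1
  · simp [signedOmega, hl]
  · rw [← abs_of_nonneg h, signedOmega, if_neg hl, if_neg hl, abs_mul, abs_div, abs_two]

lemma continuousOn_omega {lam : ℝ} (hlam2 : lam < 2) : ContinuousOn (omega lam) (Set.Ici 1) :=
  ContinuousOn.congr
    (fun _ hr => (hasDerivAt_signedOmega hlam2 hr).continuousAt.continuousWithinAt)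
    fun _ hr => omega_eq_signedOmega hlam2 hr

end Profiles

/-! ### Kernel estimates in terms of the profiles, and the limit -/

section Estimates

open Filter Topology

/-- The constant in the time-derivative bound of the heat kernel. -/
noncomputable def timeConst (lam : ℝ) : ℝ := decayConst lam * 2 ^ (1 + alpha lam)

lemma timeConst_pos {lam : ℝ} (hlam2 : lam < 2) : 0 < timeConst lam :=
  mul_pos (decayConst_pos hlam2) (by positivity)

lemma abs_kernelCol_sub_le_omega {lam : ℝ} (hlam0 : 0 ≤ lam) (hlam2 : lam < 2) {N : ℕ}
    (i j : Fin N) {s t : ℝ} (hs : 0 < s) (hst : s ≤ t) :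
    |kernelCol lam j t i - kernelCol lam j s i| ≤
      timeConst lam * s ^ (-alpha lam) * omega lam (t / s) := by
  have ha := alpha_pos hlam2
  have h1 : ∀ {τ : ℝ}, s ≤ τ → 1 ≤ τ / s := fun h => (one_le_div hs).2 h
  rw [omega_eq_signedOmega hlam2 (h1 hst)]
  have hdf : ∀ τ, s ≤ τ → HasDerivAt (fun τ => kernelCol lam j τ i - kernelCol lam j s i)
      (deriv (fun τ => kernelCol lam j τ i) τ) τ ∧
      |deriv (fun τ => kernelCol lam j τ i) τ| ≤ timeConst lam * τ ^ (-1 - alpha lam) := by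
    intro τ hτ
    obtain ⟨d, hd, hb⟩ := exists_hasDerivAt_kernelCol hlam0 hlam2 i j (hs.trans_le hτ)
    rw [hd.deriv]
    exact ⟨hd.sub_const _, hb⟩
  have hdB : ∀ τ, s ≤ τ → HasDerivAt
      (fun τ => timeConst lam * s ^ (-alpha lam) * signedOmega lam (τ / s))
      (timeConst lam * s ^ (-alpha lam) *
        ((τ / s - 1 / 2) ^ (-((1 + alpha lam) / 2)) * (1 / s))) τ := by
    intro τ hτ
    exact ((hasDerivAt_signedOmega hlam2 (h1 hτ)).comp τ
      ((hasDerivAt_id τ).div_const s)).const_mul _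
  -- Both sides vanish at `τ = s`, so comparing derivatives suffices.
  have h := image_norm_le_of_norm_deriv_right_le_deriv_boundary'
    (f := fun τ => kernelCol lam j τ i - kernelCol lam j s i)
    (f' := fun τ => deriv (fun τ => kernelCol lam j τ i) τ) (a := s) (b := t)
    (fun τ hτ => (hdf τ hτ.1).1.continuousAt.continuousWithinAt)
    (fun τ hτ => (hdf τ hτ.1).1.hasDerivWithinAt)
    (B := fun τ => timeConst lam * s ^ (-alpha lam) * signedOmega lam (τ / s))
    (B' := fun τ => timeConst lam * s ^ (-alpha lam) *
        ((τ / s - 1 / 2) ^ (-((1 + alpha lam) / 2)) * (1 / s)))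
    (by simp [div_self hs.ne', signedOmega_one])
    (fun τ hτ => (hdB τ hτ.1).continuousAt.continuousWithinAt)
    (fun τ hτ => (hdB τ hτ.1).hasDerivWithinAt)
    (fun τ hτ => by
      refine (hdf τ hτ.1).2.trans ?_
      have hr := h1 hτ.1
      rw [mul_assoc]
      refine mul_le_mul_of_nonneg_left ?_ (timeConst_pos hlam2).le
      have e : τ ^ (-1 - alpha lam) =
          s ^ (-alpha lam) * ((τ / s) ^ (-(1 + alpha lam)) * (1 / s)) := by
        have : τ = s * (τ / s) := by field_simp
        conv_lhs => rw [this]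
        rw [Real.mul_rpow hs.le (by linarith), show -1 - alpha lam = -(1 + alpha lam) by ring,
          show s ^ (-(1 + alpha lam)) = s ^ (-alpha lam) * (1 / s) by
            rw [show -(1 + alpha lam) = -alpha lam - 1 by ring, Real.rpow_sub hs, Real.rpow_one]
            ring]
        ring
      rw [e]
      -- Halving the exponent and lowering the base by `1/2` both enlarge the right side, as `τ / s
      -- ≥ 1`; the result is the derivative of `ω_λ`.
      have h2 : (τ / s) ^ (-(1 + alpha lam)) ≤ (τ / s - 1 / 2) ^ (-((1 + alpha lam) / 2)) :=
        (Real.rpow_le_rpow_of_exponent_le hr (by linarith)).trans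
          (Real.rpow_le_rpow_of_nonpos (by linarith) (by linarith) (by linarith))
      gcongr)
  exact h (Set.right_mem_Icc.2 hst)

/-- This is `α (2 - λ) = 1`. The square becomes the prefactor `t^(-α)`, the other power the scaling
factor from `theta_mul_sub`. -/
lemma rpow_scaling {lam t : ℝ} (hlam2 : lam < 2) (ht : 0 < t) :
    t ^ (-1 - alpha lam) = (t ^ (-alpha lam)) ^ 2 * (t ^ (-alpha lam)) ^ (1 - lam) := by
  rw [← Real.rpow_natCast, ← Real.rpow_mul ht.le, ← Real.rpow_mul ht.le, ← Real.rpow_add ht]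
  congr 1
  have h : (2 : ℝ) - lam ≠ 0 := by linarith
  rw [alpha]
  push_cast
  field_simp
  ring

lemma abs_kernelCol_sub_le_theta {lam : ℝ} (hlam0 : 0 ≤ lam) (hlam2 : lam < 2) {N : ℕ}
    (i₁ i₂ j : Fin N) {t : ℝ} (ht : 0 < t) :
    |kernelCol lam j t i₂ - kernelCol lam j t i₁| ≤
      2 * √(decayConst lam) * t ^ (-alpha lam) *
        |theta lam (t ^ (-alpha lam) * ((i₂ : ℝ) + 1)) -
          theta lam (t ^ (-alpha lam) * ((i₁ : ℝ) + 1))| ^ (1 / 2 : ℝ) := by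
  wlog hi : (i₁ : ℕ) ≤ i₂ generalizing i₁ i₂
  · have h := this i₂ i₁ (le_of_not_ge hi)
    rwa [abs_sub_comm, abs_sub_comm (theta lam _)] at h
  have hc : 0 < t ^ (-alpha lam) := by positivity
  have hD := decayConst_pos hlam2
  have h1 := sq_sub_kernelCol_le hlam0 hlam2 i₁ i₂ j hi ht
  have h2 := sum_rpow_neg_le_theta_sub hlam0 hlam2 hi
  rw [theta_mul_sub lam hc (by positivity) (by positivity)]
  set δ := theta lam ((i₂ : ℝ) + 1) - theta lam ((i₁ : ℝ) + 1) with hδ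
  have hs0 : 0 ≤ ∑ k ∈ Ico (i₁ : ℕ) i₂, ((k : ℝ) + 1) ^ (-lam) :=
    sum_nonneg fun k _ => by positivity
  have hδ0 : 0 ≤ δ := by linarith
  rw [abs_of_nonneg (by positivity : 0 ≤ (t ^ (-alpha lam)) ^ (1 - lam) * δ), ← Real.sqrt_eq_rpow]
  refine abs_le_of_sq_le_sq ?_ (by positivity)
  rw [mul_pow, mul_pow, mul_pow, Real.sq_sqrt hD.le, Real.sq_sqrt (by positivity)]
  refine h1.trans ?_
  rw [rpow_scaling hlam2 ht]
  have h3 := mul_le_mul_of_nonneg_right h2 (by positivity :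
    0 ≤ decayConst lam * ((t ^ (-alpha lam)) ^ 2 * (t ^ (-alpha lam)) ^ (1 - lam)))
  linarith

/-- Summability matters: a divergent `tsum` is `0`, and `normOne` would then bound nothing. -/
lemma abs_sum_mul_le_normOne {U₀ : ℕ → ℝ} (hU₀ : Summable fun k => |U₀ (k + 1)|) {N : ℕ}
    {c : Fin N → ℝ} {M : ℝ} (hM : 0 ≤ M) (hc : ∀ k, |c k| ≤ M) :
    |∑ k : Fin N, c k * U₀ (k + 1)| ≤ M * normOne U₀ := by
  calc |∑ k : Fin N, c k * U₀ (k + 1)| ≤ ∑ k : Fin N, |c k * U₀ (k + 1)| :=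
        abs_sum_le_sum_abs _ _
    _ ≤ ∑ k : Fin N, M * |U₀ (k + 1)| := by
        refine sum_le_sum fun k _ => ?_
        rw [abs_mul]
        exact mul_le_mul_of_nonneg_right (hc k) (abs_nonneg _)
    _ = M * ∑ k ∈ range N, |U₀ (k + 1)| := by
        rw [← mul_sum, Fin.sum_univ_eq_sum_range (fun k => |U₀ (k + 1)|)]
    _ ≤ M * normOne U₀ :=
        mul_le_mul_of_nonneg_left (hU₀.sum_le_tsum _ fun k _ => abs_nonneg _) hM

variable {lam mu : ℝ} {T : EReal} {U₀ : ℕ → ℝ} {U : ℝ → ℕ → ℝ}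

lemma IsSolution.abs_apply_le (hU : IsSolution lam mu T U₀ U) (hlam0 : 0 ≤ lam)
    (hlam2 : lam < 2) (hmu : 0 ≤ mu) {t : ℝ} (ht : t ∈ timeInterval T) (j : ℕ) :
    |U t (j + 1)| ≤ decayConst lam * (1 + t) ^ (-alpha lam) * normOne U₀ := by
  have ht0 : 0 ≤ t := ht.1
  have hD := decayConst_pos hlam2
  refine le_of_tendsto (hU.tendsto_truncSol hlam2 hmu ht j).abs ?_
  filter_upwards [eventually_ge_atTop j] with n hn
  rw [truncSol, extend_of_lt _ (by omega : j < n + 1)]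
  refine abs_sum_mul_le_normOne (hU.memX_init.summable_abs hmu) (by positivity) fun k => ?_
  rw [abs_of_nonneg (kernelCol_nonneg lam _ ht0 k)]
  exact kernelCol_le hlam0 hlam2 _ _ ht0

lemma IsSolution.abs_sub_space_le (hU : IsSolution lam mu T U₀ U) (hlam0 : 0 ≤ lam)
    (hlam2 : lam < 2) (hmu : 0 ≤ mu) {t : ℝ} (ht0 : 0 < t) (ht : t ∈ timeInterval T)
    (j₁ j₂ : ℕ) :
    |U t (j₂ + 1) - U t (j₁ + 1)| ≤ 2 * √(decayConst lam) * t ^ (-alpha lam) *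
        |theta lam (t ^ (-alpha lam) * ((j₂ : ℝ) + 1)) -
          theta lam (t ^ (-alpha lam) * ((j₁ : ℝ) + 1))| ^ (1 / 2 : ℝ) * normOne U₀ := by
  refine le_of_tendsto ((hU.tendsto_truncSol hlam2 hmu ht j₂).sub
    (hU.tendsto_truncSol hlam2 hmu ht j₁)).abs ?_
  filter_upwards [eventually_ge_atTop j₁, eventually_ge_atTop j₂] with n h1 h2
  rw [truncSol, extend_of_lt _ (by omega : j₁ < n + 1), extend_of_lt _ (by omega : j₂ < n + 1),
    ← sum_sub_distrib]
  simp only [← sub_mul]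
  refine abs_sum_mul_le_normOne (hU.memX_init.summable_abs hmu) (by positivity) fun k => ?_
  rw [kernelCol_comm, kernelCol_comm lam k]
  exact abs_kernelCol_sub_le_theta hlam0 hlam2 ⟨j₁, by omega⟩ ⟨j₂, by omega⟩ k ht0

lemma IsSolution.abs_sub_time_le (hU : IsSolution lam mu T U₀ U) (hlam0 : 0 ≤ lam)
    (hlam2 : lam < 2) (hmu : 0 ≤ mu) {s t : ℝ} (hs : 0 < s) (hst : s ≤ t)
    (ht : t ∈ timeInterval T) (j : ℕ) :
    |U t (j + 1) - U s (j + 1)| ≤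
      timeConst lam * s ^ (-alpha lam) * omega lam (t / s) * normOne U₀ := by
  refine le_of_tendsto ((hU.tendsto_truncSol hlam2 hmu ht j).sub
    (hU.tendsto_truncSol hlam2 hmu (Icc_subset_timeInterval ht ⟨hs.le, hst⟩) j)).abs ?_
  filter_upwards [eventually_ge_atTop j] with n hn
  rw [truncSol, truncSol, extend_of_lt _ (by omega : j < n + 1),
    extend_of_lt _ (by omega : j < n + 1), ← sum_sub_distrib]
  simp only [← sub_mul]
  refine abs_sum_mul_le_normOne (hU.memX_init.summable_abs hmu) ?_ fun k => ?_
  · have := timeConst_pos hlam2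
    have h1 : 1 ≤ t / s := (one_le_div hs).2 hst
    rw [omega_eq_signedOmega hlam2 h1]
    exact mul_nonneg (by positivity) (signedOmega_nonneg hlam2 h1)
  · exact abs_kernelCol_sub_le_omega hlam0 hlam2 _ _ hs hst

end Estimates

end WeightedHeat

/-! ### The main theorem -/

theorem mainTheorem5 (lam : ℝ) (hlam0 : 0 ≤ lam) (hlam2 : lam < 2) :
    ContinuousOn (WeightedHeat.theta lam) (Set.Ioi 0) ∧
    (lam < 1 → ∀ x : ℝ, 0 < x → 0 < WeightedHeat.theta lam x) ∧
    ContinuousOn (WeightedHeat.omega lam) (Set.Ici 1) ∧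
    (∀ r : ℝ, 1 ≤ r → 0 ≤ WeightedHeat.omega lam r) ∧
    WeightedHeat.omega lam 1 = 0 ∧
    ∃ C : ℝ, 0 < C ∧
      ∀ (mu : ℝ) (T : EReal) (U₀ : ℕ → ℝ) (U : ℝ → ℕ → ℝ),
        0 ≤ mu → 0 < T → WeightedHeat.IsSolution lam mu T U₀ U →
        (∀ t : ℝ, 0 ≤ t → (t : EReal) < T →
          BddAbove (Set.range fun k : ℕ => |U t (k + 1)|) ∧
          WeightedHeat.normSup (U t) ≤
            C * WeightedHeat.normOne U₀ * (1 + t) ^ (-WeightedHeat.alpha lam)) ∧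
        (∀ (t : ℝ) (k₁ k₂ : ℕ), 0 < t → (t : EReal) < T → 1 ≤ k₁ → 1 ≤ k₂ →
          |U t k₂ - U t k₁| ≤
            C * WeightedHeat.normOne U₀ * t ^ (-WeightedHeat.alpha lam) *
              |WeightedHeat.theta lam (t ^ (-WeightedHeat.alpha lam) * (k₂ : ℝ)) -
                WeightedHeat.theta lam (t ^ (-WeightedHeat.alpha lam) * (k₁ : ℝ))|
                  ^ (1 / 2 : ℝ)) ∧
        (∀ (s t : ℝ) (k : ℕ), 0 < s → s ≤ t → (t : EReal) < T → 1 ≤ k →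
          |U t k - U s k| ≤
            C * WeightedHeat.normOne U₀ * s ^ (-WeightedHeat.alpha lam) *
              WeightedHeat.omega lam (t / s)) := by
  have hD := WeightedHeat.decayConst_pos hlam2
  have hK := WeightedHeat.timeConst_pos hlam2
  have hω : ∀ r : ℝ, 1 ≤ r → 0 ≤ WeightedHeat.omega lam r := fun r hr => by
    rw [WeightedHeat.omega_eq_signedOmega hlam2 hr]
    exact WeightedHeat.signedOmega_nonneg hlam2 hr
  refine ⟨WeightedHeat.continuousOn_theta lam, fun h x hx => WeightedHeat.theta_pos h hx,
    WeightedHeat.continuousOn_omega hlam2, hω, ?_, ?_⟩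
  · rw [WeightedHeat.omega_eq_signedOmega hlam2 le_rfl, WeightedHeat.signedOmega_one]
  -- The three summands are the constants of the decay, space and time estimates.
  set C := WeightedHeat.decayConst lam + 2 * √(WeightedHeat.decayConst lam) +
    WeightedHeat.timeConst lam with hC
  have hs := Real.sqrt_nonneg (WeightedHeat.decayConst lam)
  refine ⟨C, by positivity, fun mu T U₀ U hmu _ hU => ?_⟩
  have hn : 0 ≤ WeightedHeat.normOne U₀ := tsum_nonneg fun k => abs_nonneg _
  refine ⟨fun t ht htT => ?_, fun t k₁ k₂ ht htT hk₁ hk₂ => ?_, fun s t k hs0 hst htT hk => ?_⟩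
  · have hb : ∀ j : ℕ, |U t (j + 1)| ≤
        C * WeightedHeat.normOne U₀ * (1 + t) ^ (-WeightedHeat.alpha lam) := by
      intro j
      refine (hU.abs_apply_le hlam0 hlam2 hmu ⟨ht, htT⟩ j).trans ?_
      rw [mul_right_comm]
      gcongr
      linarith
    -- Boundedness is recorded separately because the real supremum of an unbounded family is `0` by
    -- convention.
    exact ⟨⟨_, Set.forall_mem_range.2 hb⟩, ciSup_le hb⟩
  · obtain ⟨j₁, rfl⟩ : ∃ j, k₁ = j + 1 := ⟨k₁ - 1, by omega⟩
    obtain ⟨j₂, rfl⟩ : ∃ j, k₂ = j + 1 := ⟨k₂ - 1, by omega⟩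
    push_cast
    refine (hU.abs_sub_space_le hlam0 hlam2 hmu ht ⟨ht.le, htT⟩ j₁ j₂).trans ?_
    rw [mul_right_comm _ _ (WeightedHeat.normOne U₀), mul_right_comm _ _ (WeightedHeat.normOne U₀)]
    gcongr
    linarith
  · obtain ⟨j, rfl⟩ : ∃ j, k = j + 1 := ⟨k - 1, by omega⟩
    refine (hU.abs_sub_time_le hlam0 hlam2 hmu hs0 hst ⟨hs0.le.trans hst, htT⟩ j).trans ?_
    rw [mul_right_comm _ _ (WeightedHeat.normOne U₀), mul_right_comm _ _ (WeightedHeat.normOne U₀)]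
    have := hω _ ((one_le_div hs0).2 hst)
    gcongr
    linarith
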